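/- Let $S$ be a smooth Riemannian surface (a smooth $2$-manifold with a smooth Riemannian metric) of constant Gaussian curvature $K_S$, with Levi-Civita connection $\nabla$ and curvature tensor $R(X,Y)Z=\nabla_X\nabla_YZ-\nabla_Y\nabla_XZ-\nabla_{[X,Y]}Z$. Let $\gamma:I\to S$ be a smooth curve parametrized by arc length on an open interval $I\subset\mathbb{R}$, with unit tangent $T=\gamma'$, and suppose that $\gamma$ is triharmonic, i.e. $$\nabla_T^5T+R(\nabla_T^3T,T)T-R(\nabla_T^2T,\nabla_TT)T=0\quad\text{on } I.$$ If $K_S\le 0$, then $\gamma$ is a geodesic, i.e. $\nabla_TT=0$ on $I$. If $K_S>0$, then $\gamma$ is either a geodesic or a circle with $\kappa_g^2=2K_S$. Here a circle is a curve whose geodesic curvature $\kappa_g=\langle\nabla_TT,N\rangle$, taken with respect to a smooth unit normal field $N$ along $\gamma$, is a nonzero constant. -/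

import Mathlib

open Set Bundle
open scoped Manifold ContDiff Topology

namespace SurfaceCurve

/-- The model plane of a surface. -/
abbrev Plane : Type := EuclideanSpace ℝ (Fin 2)

/-- Partial derivative `∂_i f` of a function on the coordinate plane. -/
noncomputable def pderiv (i : Fin 2) (f : Plane → ℝ) (x : Plane) : ℝ :=
  fderiv ℝ f x (EuclideanSpace.single i 1)

section Charts

variable {M : Type*} [TopologicalSpace M] [ChartedSpace Plane M] [IsManifold (𝓡 2) ∞ M]

/-- The components of a tangent vector `v ∈ T_q M` in the preferred chart around `p₀`. -/
noncomputable def coord (p₀ q : M) (v : TangentSpace (𝓡 2) q) : Plane :=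
  (trivializationAt Plane (TangentSpace (𝓡 2)) p₀).continuousLinearMapAt ℝ q v

/-- The coordinate vector `∂_i ∈ T_q M` of the preferred chart around `p₀`. -/
noncomputable def frame (p₀ q : M) (i : Fin 2) : TangentSpace (𝓡 2) q :=
  (trivializationAt Plane (TangentSpace (𝓡 2)) p₀).symmL ℝ q (EuclideanSpace.single i 1)

/-- Components are computed by the differential of the chart. -/
theorem coord_eq_mfderiv (p₀ q : M) (hq : q ∈ (chartAt Plane p₀).source)
    (v : TangentSpace (𝓡 2) q) :
    coord p₀ q v = mfderiv (𝓡 2) 𝓘(ℝ, Plane) (extChartAt (𝓡 2) p₀) q v := by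
  unfold coord
  rw [TangentBundle.continuousLinearMapAt_trivializationAt hq]
  rfl

/-- The vectors `∂_i` have the standard components. -/
theorem coord_frame (p₀ q : M) (hq : q ∈ (chartAt Plane p₀).source) (i : Fin 2) :
    coord p₀ q (frame p₀ q i) = EuclideanSpace.single i 1 := by
  unfold coord frame
  exact Trivialization.continuousLinearMapAt_symmL _ (by simpa using hq) _

variable [RiemannianBundle (fun x : M => TangentSpace (𝓡 2) x)]

/-- The matrix `g_ij = ⟨∂_i, ∂_j⟩` of the metric in the preferred chart around `p₀`, as a function
of the coordinates `x`. -/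
noncomputable def metricMatrix (p₀ : M) (x : Plane) : Matrix (Fin 2) (Fin 2) ℝ :=
  Matrix.of fun i j =>
    inner ℝ (frame p₀ ((extChartAt (𝓡 2) p₀).symm x) i)
      (frame p₀ ((extChartAt (𝓡 2) p₀).symm x) j)

/-- The Christoffel symbols of the Levi-Civita connection,
`Γ^k_ij = ½ g^kl (∂_i g_jl + ∂_j g_il - ∂_l g_ij)`. -/
noncomputable def christoffel (p₀ : M) (x : Plane) (k i j : Fin 2) : ℝ :=
  (1 / 2) * ∑ l, (metricMatrix p₀ x)⁻¹ k l *
    (pderiv i (fun y => metricMatrix p₀ y j l) x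
      + pderiv j (fun y => metricMatrix p₀ y i l) x
      - pderiv l (fun y => metricMatrix p₀ y i j) x)

/-- The component along `∂_l` of `R(∂_i, ∂_j) ∂_k`, where
`R(X, Y) Z = ∇_X ∇_Y Z - ∇_Y ∇_X Z - ∇_[X, Y] Z`. -/
noncomputable def riemannCoeff (p₀ : M) (x : Plane) (l i j k : Fin 2) : ℝ :=
  pderiv i (fun y => christoffel p₀ y l j k) x - pderiv j (fun y => christoffel p₀ y l i k) x
    + ∑ m, (christoffel p₀ x l i m * christoffel p₀ x m j k
      - christoffel p₀ x l j m * christoffel p₀ x m i k)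

/-- The Riemann curvature tensor `R(u, v) w` at `p`. -/
noncomputable def curvatureTensor (p : M) (u v w : TangentSpace (𝓡 2) p) :
    TangentSpace (𝓡 2) p :=
  ∑ l, (∑ i, ∑ j, ∑ k, riemannCoeff p (extChartAt (𝓡 2) p p) l i j k *
    coord p p u i * coord p p v j * coord p p w k) • frame p p l

/-- The Gaussian curvature at `p`,
`⟨R(∂_1, ∂_2) ∂_2, ∂_1⟩ / (‖∂_1‖² ‖∂_2‖² - ⟨∂_1, ∂_2⟩²)`. -/
noncomputable def gaussianCurvature (p : M) : ℝ :=
  inner ℝ (curvatureTensor p (frame p p 0) (frame p p 1) (frame p p 1)) (frame p p 0) /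
    (‖frame p p 0‖ ^ 2 * ‖frame p p 1‖ ^ 2 - inner ℝ (frame p p 0) (frame p p 1) ^ 2)

/-- The velocity `T = γ'` of a curve. -/
noncomputable def velocity (γ : ℝ → M) (s : ℝ) : TangentSpace (𝓡 2) (γ s) :=
  mfderiv 𝓘(ℝ, ℝ) (𝓡 2) γ s (1 : ℝ)

/-- The covariant derivative along `γ` of a vector field `V` along `γ`, computed in the preferred
chart around `p₀`: `(∇_T V)^k = (V^k)' + Γ^k_ij T^i V^j`. -/
noncomputable def covDerivInChart (p₀ : M) (γ : ℝ → M) (V : ∀ s, TangentSpace (𝓡 2) (γ s))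
    (s : ℝ) : TangentSpace (𝓡 2) (γ s) :=
  ∑ k, (deriv (fun t => coord p₀ (γ t) (V t) k) s
    + ∑ i, ∑ j, christoffel p₀ (extChartAt (𝓡 2) p₀ (γ s)) k i j *
      coord p₀ (γ s) (velocity γ s) i * coord p₀ (γ s) (V s) j) • frame p₀ (γ s) k

/-- The covariant derivative `∇_T V` of a vector field along `γ`; at the parameter `s` it is
computed in the chart around `γ s`. -/
noncomputable def covDeriv (γ : ℝ → M) (V : ∀ s, TangentSpace (𝓡 2) (γ s)) :
    ∀ s, TangentSpace (𝓡 2) (γ s) :=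
  fun s => covDerivInChart (γ s) γ V s

/-- The iterated covariant derivatives `∇_T^n T` of the velocity. -/
noncomputable def covDerivVelocity (γ : ℝ → M) (n : ℕ) : ∀ s, TangentSpace (𝓡 2) (γ s) :=
  (covDeriv γ)^[n] (velocity γ)

/-- A smooth curve parametrized by arc length on `I`. -/
structure IsArcLengthCurve (γ : ℝ → M) (I : Set ℝ) : Prop where
  smooth : ContMDiffOn 𝓘(ℝ, ℝ) (𝓡 2) ∞ γ I
  norm_velocity : ∀ s ∈ I, ‖velocity γ s‖ = 1

/-- The tension field
`τ₃(γ) = ∇_T^5 T + R(∇_T^3 T, T) T - R(∇_T^2 T, ∇_T T) T`. -/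
noncomputable def tension₃ (γ : ℝ → M) (s : ℝ) : TangentSpace (𝓡 2) (γ s) :=
  covDerivVelocity γ 5 s
    + curvatureTensor (γ s) (covDerivVelocity γ 3 s) (velocity γ s) (velocity γ s)
    - curvatureTensor (γ s) (covDerivVelocity γ 2 s) (covDerivVelocity γ 1 s) (velocity γ s)

/-- Triharmonic curves: arc-length parametrized curves with `τ₃(γ) = 0`. -/
structure IsTriharmonicCurve (γ : ℝ → M) (I : Set ℝ) : Prop
    extends IsArcLengthCurve γ I where
  tension_eq_zero : ∀ s ∈ I, tension₃ γ s = 0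

/-- `γ` is a geodesic on `I`: `∇_T T = 0`. -/
def IsGeodesic (γ : ℝ → M) (I : Set ℝ) : Prop :=
  ∀ s ∈ I, covDeriv γ (velocity γ) s = 0

/-- `N` is a smooth unit normal field along `γ` on `I`. On an oriented surface the two choices are
`J T` and `-J T`, where `J` is the rotation by `π / 2`. -/
structure IsUnitNormal (γ : ℝ → M) (I : Set ℝ) (N : ∀ s, TangentSpace (𝓡 2) (γ s)) : Prop where
  smooth : ContMDiffOn 𝓘(ℝ, ℝ) (𝓡 2).tangent ∞
    (fun s => (⟨γ s, N s⟩ : TangentBundle (𝓡 2) M)) I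
  norm_eq_one : ∀ s ∈ I, ‖N s‖ = 1
  orthogonal : ∀ s ∈ I, inner ℝ (velocity γ s) (N s) = 0

/-- The geodesic curvature `κ_g = ⟨∇_T T, N⟩` of `γ` with respect to the unit normal `N`. -/
noncomputable def geodesicCurvature (γ : ℝ → M) (N : ∀ s, TangentSpace (𝓡 2) (γ s)) (s : ℝ) : ℝ :=
  inner ℝ (covDeriv γ (velocity γ) s) (N s)

/-- `γ` is a circle on `I`, of geodesic curvature `κ`: for a unit normal field along `γ`, the
geodesic curvature is the nonzero constant `κ`. -/
def IsCircle (γ : ℝ → M) (I : Set ℝ) (κ : ℝ) : Prop :=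
  κ ≠ 0 ∧ ∃ N : ∀ s, TangentSpace (𝓡 2) (γ s), IsUnitNormal γ I N ∧
    ∀ s ∈ I, geodesicCurvature γ N s = κ

end Charts

end SurfaceCurve

set_option linter.unusedSectionVars false
set_option synthInstance.maxHeartbeats 200000
set_option maxHeartbeats 1000000

namespace SurfaceCurve

/-! Let `k` be the geodesic curvature for a local unit normal `N`. The Frenet equations `∇_T T = k
N`, `∇_T N = -k T` and the formula `R(u, v) w = K (⟨v, w⟩ u - ⟨u, w⟩ v)` split the triharmonic
equation into a tangential part `2k³k' - 2k'k'' - k k''' = 0` and a normal part `k'''' - 10k²k'' -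
15k k'² + k⁵ + K k'' - 2K k³ = 0`.

Where `k ≠ 0`, the tangential equation has two first integrals, `c = k²k'' - (2/5)k⁵` and `d = k'² -
k⁴/5 + 2c/k`. They express `k''` and `k'²` through `k`, so after elimination the normal equation
becomes a polynomial equation in `k` with constant coefficients and nonzero leading coefficient. A
continuous function on an interval with values in a finite set is constant (`curvature_constant`).
For constant `k` the normal equation reads `k⁵ = 2K k³` (`curvature_pow_five`).

Hence `|∇_T T|² = k²` is `0` or `2K` at each point (`sq_norm_acceleration`), a statement free of the
choice of `N`. If `K ≤ 0` both cases give a geodesic; if `K > 0`, continuity on the interval selects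
one value throughout, and in the second case the normalized acceleration is a global unit normal.

The geometric input is derived from the coordinate definitions: chart independence of `∇_T`
(`covDerivInChart_eq`), metric compatibility (`hasDerivAt_inner_field`) and the form of the
curvature tensor in dimension two (`curvatureTensor_eq`). -/

theorem plane_eq_sum (v : Plane) : v = ∑ i, v i • EuclideanSpace.single i (1 : ℝ) := by
  ext j
  fin_cases j <;> simp

/-! ### Coordinate frames and the metric matrix in a chart. -/

section ChartGeometry

variable {M : Type*} [TopologicalSpace M] [ChartedSpace Plane M] [IsManifold (𝓡 2) ∞ M]

theorem frame_coord_sum (p₀ q : M) (hq : q ∈ (chartAt Plane p₀).source)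
    (v : TangentSpace (𝓡 2) q) : ∑ i, coord p₀ q v i • frame p₀ q i = v := by
  have h : (trivializationAt Plane (TangentSpace (𝓡 2)) p₀).symmL ℝ q (coord p₀ q v) = v :=
    Trivialization.symmL_continuousLinearMapAt _ (by simpa using hq) _
  conv_rhs => rw [← h]
  have h2 : coord p₀ q v = ∑ i, coord p₀ q v i • EuclideanSpace.single i (1 : ℝ) :=
    plane_eq_sum _
  conv_rhs => rw [h2]
  rw [map_sum]
  simp only [map_smul, frame]

theorem coord_injective {p₀ q : M} (hq : q ∈ (chartAt Plane p₀).source)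
    {v w : TangentSpace (𝓡 2) q} (h : coord p₀ q v = coord p₀ q w) : v = w := by
  rw [← frame_coord_sum p₀ q hq v, ← frame_coord_sum p₀ q hq w, h]

theorem coord_add (p₀ q : M) (v w : TangentSpace (𝓡 2) q) :
    coord p₀ q (v + w) = coord p₀ q v + coord p₀ q w := map_add _ _ _

theorem coord_smul (p₀ q : M) (a : ℝ) (v : TangentSpace (𝓡 2) q) :
    coord p₀ q (a • v) = a • coord p₀ q v := map_smul _ _ _

theorem coord_sum_frame (p₀ q : M) (hq : q ∈ (chartAt Plane p₀).source) (a : Fin 2 → ℝ) :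
    coord p₀ q (∑ k, a k • frame p₀ q k) = WithLp.toLp 2 a := by
  rw [Fin.sum_univ_two, coord_add, coord_smul, coord_smul, coord_frame _ _ hq, coord_frame _ _ hq]
  ext j
  fin_cases j <;> simp

/-- The target of the preferred chart around `p₀`, as an open subset of the plane. -/
theorem isOpen_target (p₀ : M) : IsOpen (extChartAt (𝓡 2) p₀).target :=
  isOpen_extChartAt_target p₀

theorem symm_mem_source {p₀ : M} {x : Plane} (hx : x ∈ (extChartAt (𝓡 2) p₀).target) :
    (extChartAt (𝓡 2) p₀).symm x ∈ (chartAt Plane p₀).source := by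
  rw [← extChartAt_source (𝓡 2)]
  exact (extChartAt (𝓡 2) p₀).map_target hx

theorem chart_mem_target {p₀ q : M} (hq : q ∈ (chartAt Plane p₀).source) :
    extChartAt (𝓡 2) p₀ q ∈ (extChartAt (𝓡 2) p₀).target :=
  (extChartAt (𝓡 2) p₀).map_source (by rwa [extChartAt_source])

variable [RiemannianBundle (fun x : M => TangentSpace (𝓡 2) x)]

theorem metricMatrix_comm (p₀ : M) (x : Plane) (i j : Fin 2) :
    metricMatrix p₀ x i j = metricMatrix p₀ x j i := by
  simp only [metricMatrix, Matrix.of_apply]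
  exact real_inner_comm _ _

theorem metricMatrix_chart {p₀ q : M} (hq : q ∈ (chartAt Plane p₀).source) (i j : Fin 2) :
    metricMatrix p₀ (extChartAt (𝓡 2) p₀ q) i j = inner ℝ (frame p₀ q i) (frame p₀ q j) := by
  simp only [metricMatrix, Matrix.of_apply]
  rw [(extChartAt (𝓡 2) p₀).left_inv (by rwa [extChartAt_source])]

/-- A kernel vector of the Gram matrix gives the components of a tangent vector of length zero. -/
theorem metricMatrix_det_ne_zero {p₀ : M} {x : Plane} (hx : x ∈ (extChartAt (𝓡 2) p₀).target) :
    (metricMatrix p₀ x).det ≠ 0 := by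
  intro h
  obtain ⟨v, hv, hv'⟩ := Matrix.exists_mulVec_eq_zero_iff.2 h
  set q := (extChartAt (𝓡 2) p₀).symm x with hq
  have hq' : q ∈ (chartAt Plane p₀).source := symm_mem_source hx
  have h1 : inner ℝ (∑ i, v i • frame p₀ q i) (∑ i, v i • frame p₀ q i) = (0 : ℝ) := by
    have e0 := congrFun hv' 0
    have e1 := congrFun hv' 1
    simp only [Matrix.mulVec, dotProduct, Fin.sum_univ_two, metricMatrix, Matrix.of_apply,
      Pi.zero_apply] at e0 e1
    simp only [Fin.sum_univ_two, inner_add_left, inner_add_right, real_inner_smul_left,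
      real_inner_smul_right]
    linear_combination v 0 * e0 + v 1 * e1
  have h2 : ∑ i, v i • frame p₀ q i = 0 := inner_self_eq_zero.1 h1
  have h3 := coord_sum_frame p₀ q hq' v
  rw [h2] at h3
  apply hv
  ext j
  have := congrArg (fun z : Plane => z j) h3
  simpa [coord] using this.symm

theorem metricMatrix_contDiffOn [IsContMDiffRiemannianBundle (𝓡 2) ∞ Plane
      (fun x : M => TangentSpace (𝓡 2) x)] (p₀ : M) (i j : Fin 2) :
    ContDiffOn ℝ ∞ (fun x => metricMatrix p₀ x i j) (extChartAt (𝓡 2) p₀).target := by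
  have key : ∀ i : Fin 2, ContMDiffOn 𝓘(ℝ, Plane) (𝓡 2).tangent ∞
      (fun x : Plane => (⟨(extChartAt (𝓡 2) p₀).symm x,
        frame p₀ ((extChartAt (𝓡 2) p₀).symm x) i⟩ : TangentBundle (𝓡 2) M))
      (extChartAt (𝓡 2) p₀).target := by
    intro i
    rw [Trivialization.contMDiffOn_iff (e := trivializationAt Plane (TangentSpace (𝓡 2)) p₀)]
    · refine ⟨contMDiffOn_extChartAt_symm p₀, ?_⟩
      -- Read in the trivialization at `p₀`, the field `∂_i` is constant, hence smooth.
      refine (contMDiffOn_const (c := EuclideanSpace.single i (1 : ℝ))).congr fun x hx => ?_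
      rw [← coord_frame p₀ _ (symm_mem_source hx) i]
      unfold coord
      rw [Trivialization.continuousLinearMapAt_apply, Trivialization.linearMapAt_apply,
        if_pos (by simpa using symm_mem_source hx)]
    · intro x hx
      have := symm_mem_source hx
      simpa [Trivialization.mem_source] using this
  rw [← contMDiffOn_iff_contDiffOn]
  exact (key i).inner_bundle (key j)

end ChartGeometry

theorem hasFDerivAt_smul_vector {E F : Type*} [NormedAddCommGroup E] [NormedSpace ℝ E]
    [NormedAddCommGroup F] [NormedSpace ℝ F] {f : E → ℝ} {x : E} {f' : E →L[ℝ] ℝ}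
    (h : HasFDerivAt f f' x) (L : F) : HasFDerivAt (fun y => f y • L) (f'.smulRight L) x :=
  h.smul_const L

/-- Derivative of the pullback of a field of bilinear forms under a map. -/
theorem fderiv_pullback_bilinear {E : Type*} [NormedAddCommGroup E] [NormedSpace ℝ E]
    {B₀ B₁ : E → E →L[ℝ] E →L[ℝ] ℝ} {τ : E → E} {x : E} (hτ : ContDiffAt ℝ 2 τ x)
    (h₀ : DifferentiableAt ℝ B₀ x) (h₁ : DifferentiableAt ℝ B₁ (τ x))
    (h : ∀ᶠ y in 𝓝 x, ∀ u v, B₀ y u v = B₁ (τ y) (fderiv ℝ τ y u) (fderiv ℝ τ y v)) (a u v : E) :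
    fderiv ℝ B₀ x a u v =
      fderiv ℝ B₁ (τ x) (fderiv ℝ τ x a) (fderiv ℝ τ x u) (fderiv ℝ τ x v)
        + B₁ (τ x) (fderiv ℝ (fderiv ℝ τ) x a u) (fderiv ℝ τ x v)
        + B₁ (τ x) (fderiv ℝ τ x u) (fderiv ℝ (fderiv ℝ τ) x a v) := by
  have d1 : HasFDerivAt τ (fderiv ℝ τ x) x := (hτ.differentiableAt (by norm_num)).hasFDerivAt
  have d2 : HasFDerivAt (fderiv ℝ τ) (fderiv ℝ (fderiv ℝ τ) x) x :=
    ((hτ.fderiv_right (m := 1) (by norm_num)).differentiableAt (by norm_num)).hasFDerivAt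
  have c : ∀ w : E, HasFDerivAt (fun y : E => w) (0 : E →L[ℝ] E) x := fun w =>
    hasFDerivAt_const w x
  have e1 := (h₀.hasFDerivAt.clm_apply (c u)).clm_apply (c v)
  have d3 : HasFDerivAt (fun y => B₁ (τ y)) ((fderiv ℝ B₁ (τ x)).comp (fderiv ℝ τ x)) x :=
    HasFDerivAt.comp (G := E →L[ℝ] E →L[ℝ] ℝ) (g := B₁) x h₁.hasFDerivAt d1
  have e2 := (d3.clm_apply (d2.clm_apply (c u))).clm_apply
    (d2.clm_apply (c v))
  have e3 := (e1.congr_of_eventuallyEq (h.mono fun y hy => (hy u v).symm)).unique e2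
  have e4 := congrArg (fun L : E →L[ℝ] ℝ => L a) e3
  simp at e4
  rw [e4]
  ring

/-! ### Christoffel symbols and the Koszul formula. -/

section ChartGeometry

variable {M : Type*} [TopologicalSpace M] [ChartedSpace Plane M] [IsManifold (𝓡 2) ∞ M]
  [RiemannianBundle (fun x : M => TangentSpace (𝓡 2) x)]

/-- The metric in the preferred chart around `p₀`, as a field of bilinear forms on the plane. -/
noncomputable def metricForm (p₀ : M) (x : Plane) : Plane →L[ℝ] Plane →L[ℝ] ℝ :=
  ∑ i, ∑ j, metricMatrix p₀ x i j •
    (EuclideanSpace.proj i : Plane →L[ℝ] ℝ).smulRight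
      (EuclideanSpace.proj j : Plane →L[ℝ] ℝ)

theorem metricForm_apply (p₀ : M) (x u v : Plane) :
    metricForm p₀ x u v = ∑ i, ∑ j, metricMatrix p₀ x i j * (u i * v j) := by
  simp [metricForm]

theorem metricForm_comm (p₀ : M) (x u v : Plane) :
    metricForm p₀ x u v = metricForm p₀ x v u := by
  simp only [metricForm_apply, Fin.sum_univ_two, metricMatrix_comm p₀ x 1 0]
  ring

theorem metricForm_coord {p₀ q : M} (hq : q ∈ (chartAt Plane p₀).source)
    (v w : TangentSpace (𝓡 2) q) :
    metricForm p₀ (extChartAt (𝓡 2) p₀ q) (coord p₀ q v) (coord p₀ q w) = inner ℝ v w := by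
  conv_rhs => rw [← frame_coord_sum p₀ q hq v, ← frame_coord_sum p₀ q hq w]
  simp only [metricForm_apply, metricMatrix_chart hq, Fin.sum_univ_two, inner_add_left,
    inner_add_right, real_inner_smul_left, real_inner_smul_right]
  ring

/-- Testing on the two basis vectors gives a linear system, solved by Cramer's rule. It turns
Koszul-type identities, known only after pairing with `w`, into identities of vectors. -/
theorem metricForm_nondegenerate {p₀ : M} {x : Plane}
    (hx : x ∈ (extChartAt (𝓡 2) p₀).target) {u v : Plane}
    (h : ∀ w, metricForm p₀ x u w = metricForm p₀ x v w) : u = v := by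
  have hdet := metricMatrix_det_ne_zero hx
  have h0 := h (EuclideanSpace.single 0 1)
  have h1 := h (EuclideanSpace.single 1 1)
  rw [Matrix.det_fin_two] at hdet
  simp [metricForm_apply, Fin.sum_univ_two] at h0 h1
  ext k
  fin_cases k
  · apply mul_left_cancel₀ hdet
    simp only [Fin.zero_eta]
    linear_combination metricMatrix p₀ x 1 1 * h0 - metricMatrix p₀ x 1 0 * h1
  · apply mul_left_cancel₀ hdet
    simp only [Fin.mk_one]
    linear_combination metricMatrix p₀ x 0 0 * h1 - metricMatrix p₀ x 0 1 * h0

/-- The bilinear map with coefficients the Christoffel symbols. -/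
noncomputable def christoffelMap (p₀ : M) (x u v : Plane) : Plane :=
  WithLp.toLp 2 fun k => ∑ i, ∑ j, christoffel p₀ x k i j * u i * v j

theorem fderiv_eq_sum_pderiv (f : Plane → ℝ) (x a : Plane) :
    fderiv ℝ f x a = ∑ k, a k * pderiv k f x := by
  conv_lhs => rw [plane_eq_sum a]
  simp only [map_sum, map_smul, smul_eq_mul, pderiv]

/-- Lowering the upper index cancels the inverse matrix in the definition of the Christoffel
symbols. -/
theorem koszul_index {p₀ : M} {x : Plane} (hx : x ∈ (extChartAt (𝓡 2) p₀).target)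
    (i j m : Fin 2) :
    2 * ∑ k, metricMatrix p₀ x k m * christoffel p₀ x k i j =
      pderiv i (fun y => metricMatrix p₀ y j m) x + pderiv j (fun y => metricMatrix p₀ y i m) x
        - pderiv m (fun y => metricMatrix p₀ y i j) x := by
  have hdet := metricMatrix_det_ne_zero hx
  have hmul := Matrix.mul_nonsing_inv (metricMatrix p₀ x) (isUnit_iff_ne_zero.2 hdet)
  set D : Fin 2 → ℝ := fun l => pderiv i (fun y => metricMatrix p₀ y j l) x
    + pderiv j (fun y => metricMatrix p₀ y i l) x
    - pderiv l (fun y => metricMatrix p₀ y i j) x with hD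
  have h1 : (metricMatrix p₀ x * (metricMatrix p₀ x)⁻¹).mulVec D m = D m := by
    rw [hmul, Matrix.one_mulVec]
  rw [← Matrix.mulVec_mulVec] at h1
  change _ = D m
  rw [← h1, Finset.sum_congr rfl fun k _ => by rw [metricMatrix_comm p₀ x k m]]
  simp only [christoffel, Matrix.mulVec, dotProduct, Fin.sum_univ_two, hD]
  ring

variable [IsContMDiffRiemannianBundle (𝓡 2) ∞ Plane (fun x : M => TangentSpace (𝓡 2) x)]

theorem metricMatrix_contDiffAt {p₀ : M} {x : Plane} (hx : x ∈ (extChartAt (𝓡 2) p₀).target)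
    (i j : Fin 2) : ContDiffAt ℝ ∞ (fun y => metricMatrix p₀ y i j) x :=
  (metricMatrix_contDiffOn p₀ i j).contDiffAt ((isOpen_target p₀).mem_nhds hx)

theorem pderiv_contDiffAt {f : Plane → ℝ} {x : Plane} (hf : ContDiffAt ℝ ∞ f x) (i : Fin 2) :
    ContDiffAt ℝ ∞ (pderiv i f) x :=
  (hf.fderiv_right (m := ∞) (by simp)).clm_apply contDiffAt_const

theorem christoffel_contDiffAt {p₀ : M} {x : Plane} (hx : x ∈ (extChartAt (𝓡 2) p₀).target)
    (k i j : Fin 2) : ContDiffAt ℝ ∞ (fun y => christoffel p₀ y k i j) x := by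
  have hg := metricMatrix_contDiffAt (M := M) hx
  have hdet := metricMatrix_det_ne_zero hx
  have hdet' : ContDiffAt ℝ ∞ (fun y => (metricMatrix p₀ y).det) x := by
    simp only [Matrix.det_fin_two]
    exact ((hg 0 0).mul (hg 1 1)).sub ((hg 0 1).mul (hg 1 0))
  have hinv : ∀ k l, ContDiffAt ℝ ∞ (fun y => (metricMatrix p₀ y)⁻¹ k l) x := by
    intro k l
    have hi := hdet'.inv hdet
    -- The inverse as adjugate over determinant: its entries are visibly smooth.
    simp only [Matrix.inv_def, Matrix.adjugate_fin_two, Ring.inverse_eq_inv', Matrix.smul_apply,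
      smul_eq_mul]
    fin_cases k <;> fin_cases l <;> simp
    · exact hi.mul (hg 1 1)
    · exact (hi.mul (hg 0 1)).neg
    · exact (hi.mul (hg 1 0)).neg
    · exact hi.mul (hg 0 0)
  unfold christoffel
  refine contDiffAt_const.mul (ContDiffAt.sum fun l _ => (hinv k l).mul ?_)
  exact ((pderiv_contDiffAt (hg j l) i).add (pderiv_contDiffAt (hg i l) j)).sub
    (pderiv_contDiffAt (hg i j) l)

theorem metricForm_hasFDerivAt {p₀ : M} {x : Plane} (hx : x ∈ (extChartAt (𝓡 2) p₀).target) :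
    HasFDerivAt (metricForm p₀) (∑ i, ∑ j, (fderiv ℝ (fun y => metricMatrix p₀ y i j) x).smulRight
      ((EuclideanSpace.proj i : Plane →L[ℝ] ℝ).smulRight
      (EuclideanSpace.proj j : Plane →L[ℝ] ℝ))) x := by
  unfold metricForm
  refine HasFDerivAt.fun_sum (𝕜 := ℝ) (E := Plane) (F := Plane →L[ℝ] Plane →L[ℝ] ℝ) fun i _ => ?_
  refine HasFDerivAt.fun_sum (𝕜 := ℝ) (E := Plane) (F := Plane →L[ℝ] Plane →L[ℝ] ℝ) fun j _ => ?_
  have h : HasFDerivAt (fun y => metricMatrix p₀ y i j)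
      (fderiv ℝ (fun y => metricMatrix p₀ y i j) x) x :=
    ((metricMatrix_contDiffAt hx i j).differentiableAt (by simp)).hasFDerivAt
  exact hasFDerivAt_smul_vector (E := Plane) (F := Plane →L[ℝ] Plane →L[ℝ] ℝ) h
    ((EuclideanSpace.proj i : Plane →L[ℝ] ℝ).smulRight (EuclideanSpace.proj j : Plane →L[ℝ] ℝ))

theorem fderiv_metricForm {p₀ : M} {x : Plane} (hx : x ∈ (extChartAt (𝓡 2) p₀).target)
    (a u v : Plane) : fderiv ℝ (metricForm p₀) x a u v =
      ∑ i, ∑ j, (∑ k, a k * pderiv k (fun y => metricMatrix p₀ y i j) x) * (u i * v j) := by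
  rw [(metricForm_hasFDerivAt hx).fderiv]
  simp only [_root_.sum_apply, ContinuousLinearMap.smulRight_apply,
    fderiv_eq_sum_pderiv, _root_.smul_apply, smul_eq_mul, PiLp.proj_apply]

/-- The Koszul formula for coordinate vector fields. -/
theorem koszul {p₀ : M} {x : Plane} (hx : x ∈ (extChartAt (𝓡 2) p₀).target) (u v w : Plane) :
    2 * metricForm p₀ x (christoffelMap p₀ x u v) w =
      fderiv ℝ (metricForm p₀) x u v w + fderiv ℝ (metricForm p₀) x v u w
        - fderiv ℝ (metricForm p₀) x w u v := by
  have K := koszul_index (M := M) hx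
  simp only [fderiv_metricForm hx, metricForm_apply, christoffelMap, Fin.sum_univ_two] at K ⊢
  linear_combination
    u 0 * v 0 * w 0 * K 0 0 0 + u 0 * v 0 * w 1 * K 0 0 1 + u 0 * v 1 * w 0 * K 0 1 0
    + u 0 * v 1 * w 1 * K 0 1 1 + u 1 * v 0 * w 0 * K 1 0 0 + u 1 * v 0 * w 1 * K 1 0 1
    + u 1 * v 1 * w 0 * K 1 1 0 + u 1 * v 1 * w 1 * K 1 1 1

theorem metricForm_differentiableAt {p₀ : M} {x : Plane}
    (hx : x ∈ (extChartAt (𝓡 2) p₀).target) : DifferentiableAt ℝ (metricForm p₀) x :=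
  (metricForm_hasFDerivAt hx).differentiableAt

theorem fderiv_metricForm_comm {p₀ : M} {x : Plane} (hx : x ∈ (extChartAt (𝓡 2) p₀).target)
    (a u v : Plane) :
    fderiv ℝ (metricForm p₀) x a u v = fderiv ℝ (metricForm p₀) x a v u := by
  have h : ∀ i j, (fun y => metricMatrix p₀ y i j) = fun y => metricMatrix p₀ y j i :=
    fun i j => funext fun y => metricMatrix_comm p₀ y i j
  simp only [fderiv_metricForm hx, Fin.sum_univ_two, h 1 0]
  ring

/-- Compatibility of the connection with the metric, in coordinates. -/
theorem fderiv_metricForm_eq {p₀ : M} {x : Plane} (hx : x ∈ (extChartAt (𝓡 2) p₀).target)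
    (a u v : Plane) :
    fderiv ℝ (metricForm p₀) x a u v =
      metricForm p₀ x (christoffelMap p₀ x a u) v + metricForm p₀ x u (christoffelMap p₀ x a v) := by
  -- In the sum of the Koszul formulas for `(a, u, v)` and `(a, v, u)` the derivatives along `u` and
  -- `v` cancel.
  have h1 := koszul hx a u v
  have h2 := koszul hx a v u
  rw [metricForm_comm _ _ u]
  have h3 := fderiv_metricForm_comm hx a u v
  have h4 := fderiv_metricForm_comm hx u v a
  have h5 := fderiv_metricForm_comm hx v u a
  linarith

end ChartGeometry

/-! ### Transition maps and smooth fields along a curve. -/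

section FieldsAlong

variable {M : Type*} [TopologicalSpace M] [ChartedSpace Plane M] [IsManifold (𝓡 2) ∞ M]

/-- The transition map between two preferred charts. -/
noncomputable def transition (p₀ p₁ : M) : Plane → Plane :=
  extChartAt (𝓡 2) p₁ ∘ (extChartAt (𝓡 2) p₀).symm

theorem transition_chart {p₀ p₁ q : M} (hq : q ∈ (chartAt Plane p₀).source) :
    transition p₀ p₁ (extChartAt (𝓡 2) p₀ q) = extChartAt (𝓡 2) p₁ q := by
  unfold transition
  rw [Function.comp_apply, (extChartAt (𝓡 2) p₀).left_inv (by rwa [extChartAt_source])]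

theorem transition_contDiffAt {p₀ p₁ q : M} (h₀ : q ∈ (chartAt Plane p₀).source)
    (h₁ : q ∈ (chartAt Plane p₁).source) :
    ContDiffAt ℝ ∞ (transition p₀ p₁) (extChartAt (𝓡 2) p₀ q) := by
  have h := contDiffWithinAt_ext_coord_change (I := 𝓡 2) (n := ∞) p₁ p₀
    (y := extChartAt (𝓡 2) p₀ q) (by
      rw [PartialEquiv.trans_source, PartialEquiv.symm_source]
      refine ⟨chart_mem_target h₀, ?_⟩
      rw [mem_preimage, (extChartAt (𝓡 2) p₀).left_inv (by rwa [extChartAt_source]),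
        extChartAt_source]
      exact h₁)
  rw [modelWithCornersSelf_coe, range_id, contDiffWithinAt_univ] at h
  exact h

theorem coord_transition {p₀ p₁ q : M} (h₀ : q ∈ (chartAt Plane p₀).source)
    (h₁ : q ∈ (chartAt Plane p₁).source) (v : TangentSpace (𝓡 2) q) :
    coord p₁ q v = fderiv ℝ (transition p₀ p₁) (extChartAt (𝓡 2) p₀ q) (coord p₀ q v) := by
  rw [coord_eq_mfderiv p₁ q h₁, coord_eq_mfderiv p₀ q h₀, ← mfderiv_eq_fderiv]
  have hev : (extChartAt (𝓡 2) p₁ : M → Plane) =ᶠ[𝓝 q]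
      transition p₀ p₁ ∘ extChartAt (𝓡 2) p₀ := by
    filter_upwards [(chartAt Plane p₀).open_source.mem_nhds h₀] with y hy
    exact (transition_chart hy).symm
  have hτ : MDifferentiableAt 𝓘(ℝ, Plane) 𝓘(ℝ, Plane) (transition p₀ p₁)
      (extChartAt (𝓡 2) p₀ q) :=
    ((transition_contDiffAt h₀ h₁).differentiableAt (by simp)).mdifferentiableAt
  have : IsManifold (𝓡 2) 1 M := IsManifold.of_le (n := ∞) (by simp)
  rw [hev.mfderiv_eq, mfderiv_comp q hτ (mdifferentiableAt_extChartAt h₀)]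
  rfl

theorem hasDerivAt_chart {γ : ℝ → M} {s : ℝ} (hγ : MDifferentiableAt 𝓘(ℝ, ℝ) (𝓡 2) γ s) {p₀ : M}
    (h₀ : γ s ∈ (chartAt Plane p₀).source) :
    HasDerivAt (fun t => extChartAt (𝓡 2) p₀ (γ t)) (coord p₀ (γ s) (velocity γ s)) s := by
  have : IsManifold (𝓡 2) 1 M := IsManifold.of_le (n := ∞) (by simp)
  have hφ := mdifferentiableAt_extChartAt (I := 𝓡 2) h₀
  have hd : MDifferentiableAt 𝓘(ℝ, ℝ) 𝓘(ℝ, Plane) (extChartAt (𝓡 2) p₀ ∘ γ) s := hφ.comp s hγ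
  have h : HasDerivAt (extChartAt (𝓡 2) p₀ ∘ γ) (fderiv ℝ (extChartAt (𝓡 2) p₀ ∘ γ) s 1) s :=
    hd.differentiableAt.hasFDerivAt.hasDerivAt
  rw [coord_eq_mfderiv p₀ _ h₀]
  rw [← mfderiv_eq_fderiv, mfderiv_comp s hφ hγ] at h
  exact h

/-- A smooth vector field along a curve. -/
def IsSmoothField (γ : ℝ → M) (I : Set ℝ) (V : ∀ s, TangentSpace (𝓡 2) (γ s)) : Prop :=
  ContMDiffOn 𝓘(ℝ, ℝ) (𝓡 2).tangent ∞
    (fun s => (⟨γ s, V s⟩ : TangentBundle (𝓡 2) M)) I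

variable {γ : ℝ → M} {I : Set ℝ} {V W : ∀ s, TangentSpace (𝓡 2) (γ s)} {s : ℝ} {p₀ : M}

theorem eventually_mem_source (hIo : IsOpen I) (hγ : ContMDiffOn 𝓘(ℝ, ℝ) (𝓡 2) ∞ γ I)
    (hs : s ∈ I) (h₀ : γ s ∈ (chartAt Plane p₀).source) :
    ∀ᶠ t in 𝓝 s, γ t ∈ (chartAt Plane p₀).source :=
  (hγ.continuousOn.continuousAt (hIo.mem_nhds hs)).eventually
    ((chartAt Plane p₀).open_source.mem_nhds h₀)

theorem trivialization_snd {q : M} (hq : q ∈ (chartAt Plane p₀).source)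
    (v : TangentSpace (𝓡 2) q) :
    (trivializationAt Plane (TangentSpace (𝓡 2)) p₀ (⟨q, v⟩ : TangentBundle (𝓡 2) M)).2 =
      coord p₀ q v := by
  unfold coord
  rw [Trivialization.continuousLinearMapAt_apply, Trivialization.linearMapAt_apply,
    if_pos (by simpa using hq)]

/-- Any chart around `γ s` may be used to test smoothness; this frees the arguments from the chart
at `γ t` moving with `t`. -/
theorem contMDiffAt_field_iff (hIo : IsOpen I) (hγ : ContMDiffOn 𝓘(ℝ, ℝ) (𝓡 2) ∞ γ I)
    (hs : s ∈ I) (h₀ : γ s ∈ (chartAt Plane p₀).source) :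
    ContMDiffAt 𝓘(ℝ, ℝ) (𝓡 2).tangent ∞ (fun s => (⟨γ s, V s⟩ : TangentBundle (𝓡 2) M)) s ↔
      ContDiffAt ℝ ∞ (fun t => coord p₀ (γ t) (V t)) s := by
  have hev : (fun t => (trivializationAt Plane (TangentSpace (𝓡 2)) p₀
      (⟨γ t, V t⟩ : TangentBundle (𝓡 2) M)).2) =ᶠ[𝓝 s] fun t => coord p₀ (γ t) (V t) :=
    (eventually_mem_source hIo hγ hs h₀).mono fun t ht => trivialization_snd ht (V t)
  rw [Trivialization.contMDiffAt_iff (e := trivializationAt Plane (TangentSpace (𝓡 2)) p₀)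
    (by simpa [Trivialization.mem_source] using h₀), ← contMDiffAt_iff_contDiffAt,
    hev.contMDiffAt_iff]
  exact ⟨fun h => h.2, fun h => ⟨hγ.contMDiffAt (hIo.mem_nhds hs), h⟩⟩

theorem IsSmoothField.coord_contDiffAt (hIo : IsOpen I)
    (hγ : ContMDiffOn 𝓘(ℝ, ℝ) (𝓡 2) ∞ γ I) (hV : IsSmoothField γ I V)
    (hs : s ∈ I) (h₀ : γ s ∈ (chartAt Plane p₀).source) :
    ContDiffAt ℝ ∞ (fun t => coord p₀ (γ t) (V t)) s :=
  (contMDiffAt_field_iff hIo hγ hs h₀).1 (hV.contMDiffAt (hIo.mem_nhds hs))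

theorem isSmoothField_of_coord (hIo : IsOpen I)
    (hγ : ContMDiffOn 𝓘(ℝ, ℝ) (𝓡 2) ∞ γ I)
    (h : ∀ s ∈ I, ContDiffAt ℝ ∞ (fun t => coord (γ s) (γ t) (V t)) s) : IsSmoothField γ I V :=
  fun s hs => ((contMDiffAt_field_iff hIo hγ hs (mem_chart_source Plane (γ s))).2
    (h s hs)).contMDiffWithinAt

theorem chart_contDiffAt (hIo : IsOpen I) (hγ : ContMDiffOn 𝓘(ℝ, ℝ) (𝓡 2) ∞ γ I)
    (hs : s ∈ I) (h₀ : γ s ∈ (chartAt Plane p₀).source) :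
    ContDiffAt ℝ ∞ (fun t => extChartAt (𝓡 2) p₀ (γ t)) s := by
  rw [← contMDiffAt_iff_contDiffAt]
  exact (contMDiffAt_extChartAt' (I := 𝓡 2) h₀).comp s (hγ.contMDiffAt (hIo.mem_nhds hs))

theorem mdifferentiableAt_curve (hIo : IsOpen I) (hγ : ContMDiffOn 𝓘(ℝ, ℝ) (𝓡 2) ∞ γ I)
    (hs : s ∈ I) : MDifferentiableAt 𝓘(ℝ, ℝ) (𝓡 2) γ s :=
  (hγ.contMDiffAt (hIo.mem_nhds hs)).mdifferentiableAt (by simp)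

theorem isSmoothField_velocity (hIo : IsOpen I) (hγ : ContMDiffOn 𝓘(ℝ, ℝ) (𝓡 2) ∞ γ I) :
    IsSmoothField γ I (velocity γ) := by
  refine isSmoothField_of_coord hIo hγ fun s hs => ?_
  have h₀ := mem_chart_source Plane (γ s)
  have h := chart_contDiffAt hIo hγ hs h₀
  have h2 : ContDiffAt ℝ ∞ (deriv fun t => extChartAt (𝓡 2) (γ s) (γ t)) s :=
    (h.fderiv_right (m := ∞) (by simp)).clm_apply contDiffAt_const
  refine h2.congr_of_eventuallyEq ?_
  filter_upwards [eventually_mem_source hIo hγ hs h₀, hIo.mem_nhds hs] with t ht htI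
  exact ((hasDerivAt_chart (mdifferentiableAt_curve hIo hγ htI) ht).deriv).symm

theorem IsSmoothField.mono {J : Set ℝ} (hV : IsSmoothField γ I V) (h : J ⊆ I) :
    IsSmoothField γ J V := ContMDiffOn.mono hV h

theorem IsSmoothField.add (hIo : IsOpen I) (hγ : ContMDiffOn 𝓘(ℝ, ℝ) (𝓡 2) ∞ γ I)
    (hV : IsSmoothField γ I V) (hW : IsSmoothField γ I W) :
    IsSmoothField γ I (fun s => V s + W s) := by
  refine isSmoothField_of_coord hIo hγ fun s hs => ?_
  have h₀ := mem_chart_source Plane (γ s)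
  simp only [coord_add]
  exact (hV.coord_contDiffAt hIo hγ hs h₀).add (hW.coord_contDiffAt hIo hγ hs h₀)

theorem IsSmoothField.smul (hIo : IsOpen I) (hγ : ContMDiffOn 𝓘(ℝ, ℝ) (𝓡 2) ∞ γ I)
    {f : ℝ → ℝ} (hf : ContDiffOn ℝ ∞ f I) (hV : IsSmoothField γ I V) :
    IsSmoothField γ I (fun s => f s • V s) := by
  refine isSmoothField_of_coord hIo hγ fun s hs => ?_
  have h₀ := mem_chart_source Plane (γ s)
  simp only [coord_smul]
  exact (hf.contDiffAt (hIo.mem_nhds hs)).smul (hV.coord_contDiffAt hIo hγ hs h₀)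

end FieldsAlong

theorem hasDerivAt_comp_of_differentiableAt {E F : Type*} [NormedAddCommGroup E]
    [NormedSpace ℝ E] [NormedAddCommGroup F] [NormedSpace ℝ F] {B : E → F} {c : ℝ → E} {c' : E}
    {s : ℝ} (hB : DifferentiableAt ℝ B (c s)) (hc : HasDerivAt c c' s) :
    HasDerivAt (fun t => B (c t)) (fderiv ℝ B (c s) c') s :=
  hB.hasFDerivAt.comp_hasDerivAt s hc

/-! ### Covariant derivative along a curve: chart independence, compatibility, Leibniz rule. -/

section CovariantDerivative

variable {M : Type*} [TopologicalSpace M] [ChartedSpace Plane M] [IsManifold (𝓡 2) ∞ M]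
  [RiemannianBundle (fun x : M => TangentSpace (𝓡 2) x)]

theorem coord_surjective {p₀ q : M} (hq : q ∈ (chartAt Plane p₀).source) (u : Plane) :
    ∃ v : TangentSpace (𝓡 2) q, coord p₀ q v = u :=
  ⟨∑ k, u k • frame p₀ q k, coord_sum_frame p₀ q hq _⟩

theorem metricForm_transition {p₀ p₁ q : M} (h₀ : q ∈ (chartAt Plane p₀).source)
    (h₁ : q ∈ (chartAt Plane p₁).source) (u v : Plane) :
    metricForm p₀ (extChartAt (𝓡 2) p₀ q) u v =
      metricForm p₁ (transition p₀ p₁ (extChartAt (𝓡 2) p₀ q))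
        (fderiv ℝ (transition p₀ p₁) (extChartAt (𝓡 2) p₀ q) u)
        (fderiv ℝ (transition p₀ p₁) (extChartAt (𝓡 2) p₀ q) v) := by
  obtain ⟨u, rfl⟩ := coord_surjective h₀ u
  obtain ⟨v, rfl⟩ := coord_surjective h₀ v
  rw [metricForm_coord h₀, ← coord_transition h₀ h₁, ← coord_transition h₀ h₁,
    transition_chart h₀, metricForm_coord h₁]

variable [IsContMDiffRiemannianBundle (𝓡 2) ∞ Plane (fun x : M => TangentSpace (𝓡 2) x)]

/-- The transformation law of the Christoffel symbols. -/
theorem christoffelMap_transition {p₀ p₁ q : M} (h₀ : q ∈ (chartAt Plane p₀).source)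
    (h₁ : q ∈ (chartAt Plane p₁).source) {x : Plane} (hx : x = extChartAt (𝓡 2) p₀ q)
    (u v : Plane) :
    fderiv ℝ (transition p₀ p₁) x (christoffelMap p₀ x u v) =
      christoffelMap p₁ (transition p₀ p₁ x) (fderiv ℝ (transition p₀ p₁) x u)
          (fderiv ℝ (transition p₀ p₁) x v)
        + fderiv ℝ (fderiv ℝ (transition p₀ p₁)) x u v := by
  have hx₀ : x ∈ (extChartAt (𝓡 2) p₀).target := hx ▸ chart_mem_target h₀
  have hx₁ : transition p₀ p₁ x ∈ (extChartAt (𝓡 2) p₁).target := by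
    rw [hx, transition_chart h₀]
    exact chart_mem_target h₁
  have hτ : ContDiffAt ℝ ∞ (transition p₀ p₁) x := hx ▸ transition_contDiffAt h₀ h₁
  have hB : ∀ᶠ y in 𝓝 x, ∀ u v, metricForm p₀ y u v =
      metricForm p₁ (transition p₀ p₁ y) (fderiv ℝ (transition p₀ p₁) y u)
        (fderiv ℝ (transition p₀ p₁) y v) := by
    have hc : ContinuousAt (extChartAt (𝓡 2) p₀).symm x :=
      (continuousOn_extChartAt_symm p₀).continuousAt ((isOpen_target p₀).mem_nhds hx₀)
    have hq : (extChartAt (𝓡 2) p₀).symm x = q := by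
      rw [hx, (extChartAt (𝓡 2) p₀).left_inv (by rwa [extChartAt_source])]
    filter_upwards [(isOpen_target p₀).mem_nhds hx₀,
      hc.eventually ((chartAt Plane p₁).open_source.mem_nhds (by rwa [hq]))] with y hy hy' u v
    have h := metricForm_transition (symm_mem_source hy) hy' u v
    rwa [(extChartAt (𝓡 2) p₀).right_inv hy] at h
  have hD := fderiv_pullback_bilinear (hτ.of_le (by norm_cast))
    (metricForm_differentiableAt hx₀) (metricForm_differentiableAt hx₁) hB
  have hsymm : ∀ a b, fderiv ℝ (fderiv ℝ (transition p₀ p₁)) x a b =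
      fderiv ℝ (fderiv ℝ (transition p₀ p₁)) x b a :=
    fun a b => (hτ.isSymmSndFDerivAt (by simp; norm_cast)).eq a b
  have hsurj : ∀ w' : Plane, ∃ w, fderiv ℝ (transition p₀ p₁) x w = w' := by
    intro w'
    obtain ⟨v, rfl⟩ := coord_surjective h₁ w'
    exact ⟨coord p₀ q v, by rw [hx, ← coord_transition h₀ h₁]⟩
  -- The differential of the transition map is onto, so it suffices to pair with images `Dτ w` and
  -- compare the Koszul formulas of the two charts.
  refine metricForm_nondegenerate hx₁ fun w' => ?_
  obtain ⟨w, rfl⟩ := hsurj w'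
  have k₀ := koszul hx₀ u v w
  have k₁ := koszul hx₁ (fderiv ℝ (transition p₀ p₁) x u) (fderiv ℝ (transition p₀ p₁) x v)
    (fderiv ℝ (transition p₀ p₁) x w)
  -- Pulling back the metric produces six terms with `D²τ`; by its symmetry four cancel, and the
  -- other two add up to `2 g(D²τ(u, v), Dτ w)`.
  rw [hD, hD, hD, hB.self_of_nhds] at k₀
  rw [map_add, _root_.add_apply]
  have s1 := hsymm v u
  have s2 := hsymm w u
  have s3 := hsymm w v
  have c1 := metricForm_comm p₁ (transition p₀ p₁ x) (fderiv ℝ (transition p₀ p₁) x v)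
    (fderiv ℝ (fderiv ℝ (transition p₀ p₁)) x u w)
  have c2 := metricForm_comm p₁ (transition p₀ p₁ x) (fderiv ℝ (transition p₀ p₁) x u)
    (fderiv ℝ (fderiv ℝ (transition p₀ p₁)) x v w)
  rw [s1, s2, s3] at k₀
  linarith

variable {γ : ℝ → M} {I : Set ℝ} {V W : ∀ s, TangentSpace (𝓡 2) (γ s)} {s : ℝ} {p₀ p₁ : M}

theorem coord_covDerivInChart (h₀ : γ s ∈ (chartAt Plane p₀).source)
    (hV : DifferentiableAt ℝ (fun t => coord p₀ (γ t) (V t)) s) :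
    coord p₀ (γ s) (covDerivInChart p₀ γ V s) = deriv (fun t => coord p₀ (γ t) (V t)) s
      + christoffelMap p₀ (extChartAt (𝓡 2) p₀ (γ s)) (coord p₀ (γ s) (velocity γ s))
        (coord p₀ (γ s) (V s)) := by
  unfold covDerivInChart
  rw [coord_sum_frame p₀ _ h₀]
  ext k
  have h : HasDerivAt (fun t => coord p₀ (γ t) (V t) k)
      (deriv (fun t => coord p₀ (γ t) (V t)) s k) s :=
    (EuclideanSpace.proj k : Plane →L[ℝ] ℝ).hasFDerivAt.comp_hasDerivAt s hV.hasDerivAt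
  simp only [h.deriv, christoffelMap, PiLp.add_apply]

/-- The covariant derivative along a curve does not depend on the chart. -/
theorem covDerivInChart_eq (hIo : IsOpen I) (hγ : ContMDiffOn 𝓘(ℝ, ℝ) (𝓡 2) ∞ γ I) (hs : s ∈ I)
    (hV : IsSmoothField γ I V) (h₀ : γ s ∈ (chartAt Plane p₀).source)
    (h₁ : γ s ∈ (chartAt Plane p₁).source) :
    covDerivInChart p₀ γ V s = covDerivInChart p₁ γ V s := by
  have d₀ := (hV.coord_contDiffAt hIo hγ hs h₀).differentiableAt (by simp)
  have d₁ := (hV.coord_contDiffAt hIo hγ hs h₁).differentiableAt (by simp)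
  refine coord_injective h₁ ?_
  rw [coord_covDerivInChart h₁ d₁, coord_transition h₀ h₁, coord_covDerivInChart h₀ d₀, map_add,
    christoffelMap_transition h₀ h₁ rfl, ← coord_transition h₀ h₁, ← coord_transition h₀ h₁,
    transition_chart h₀]
  have hτ := transition_contDiffAt h₀ h₁
  have e1 : HasDerivAt (fun t => fderiv ℝ (transition p₀ p₁) (extChartAt (𝓡 2) p₀ (γ t)))
      (fderiv ℝ (fderiv ℝ (transition p₀ p₁)) (extChartAt (𝓡 2) p₀ (γ s))
        (coord p₀ (γ s) (velocity γ s))) s :=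
    hasDerivAt_comp_of_differentiableAt (E := Plane) (F := Plane →L[ℝ] Plane)
      ((hτ.fderiv_right (m := ∞) (by simp)).differentiableAt (by simp))
      (hasDerivAt_chart (mdifferentiableAt_curve hIo hγ hs) h₀)
  have e2 := e1.clm_apply d₀.hasDerivAt
  have hev : (fun t => coord p₁ (γ t) (V t)) =ᶠ[𝓝 s] fun t =>
      fderiv ℝ (transition p₀ p₁) (extChartAt (𝓡 2) p₀ (γ t)) (coord p₀ (γ t) (V t)) := by
    filter_upwards [eventually_mem_source hIo hγ hs h₀, eventually_mem_source hIo hγ hs h₁]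
      with t ht₀ ht₁
    exact coord_transition ht₀ ht₁ (V t)
  -- The term `D²τ(T, V)` of the product rule is the inhomogeneous term in the transformation law of
  -- the Christoffel symbols.
  rw [(e2.congr_of_eventuallyEq hev).deriv]
  abel

theorem IsSmoothField.covDeriv (hIo : IsOpen I) (hγ : ContMDiffOn 𝓘(ℝ, ℝ) (𝓡 2) ∞ γ I)
    (hV : IsSmoothField γ I V) : IsSmoothField γ I (covDeriv γ V) := by
  refine isSmoothField_of_coord hIo hγ fun s hs => ?_
  have h₀ := mem_chart_source Plane (γ s)
  have hd := hV.coord_contDiffAt hIo hγ hs h₀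
  have hT := (isSmoothField_velocity hIo hγ).coord_contDiffAt hIo hγ hs h₀
  have h1 : ContDiffAt ℝ ∞ (deriv fun t => coord (γ s) (γ t) (V t)) s :=
    (hd.fderiv_right (m := ∞) (by simp)).clm_apply contDiffAt_const
  have comp : ∀ {f : ℝ → Plane}, ContDiffAt ℝ ∞ f s → ∀ i, ContDiffAt ℝ ∞ (fun t => f t i) s :=
    fun hf i => (EuclideanSpace.proj i : Plane →L[ℝ] ℝ).contDiff.contDiffAt.comp s hf
  have h2 : ContDiffAt ℝ ∞ (fun t => christoffelMap (γ s) (extChartAt (𝓡 2) (γ s) (γ t))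
      (coord (γ s) (γ t) (velocity γ t)) (coord (γ s) (γ t) (V t))) s := by
    refine contDiffAt_euclidean.2 fun k => ?_
    have h : ∀ i j, ContDiffAt ℝ ∞ (fun t =>
        christoffel (γ s) (extChartAt (𝓡 2) (γ s) (γ t)) k i j *
          coord (γ s) (γ t) (velocity γ t) i * coord (γ s) (γ t) (V t) j) s := fun i j =>
      ((ContDiffAt.comp (g := fun y => christoffel (γ s) y k i j) s
        (christoffel_contDiffAt (chart_mem_target h₀) k i j)
        (chart_contDiffAt hIo hγ hs h₀)).mul (comp hT i)).mul (comp hd j)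
    simp only [christoffelMap, Fin.sum_univ_two]
    exact ((h 0 0).add (h 0 1)).add ((h 1 0).add (h 1 1))
  refine (h1.add h2).congr_of_eventuallyEq ?_
  filter_upwards [eventually_mem_source hIo hγ hs h₀, hIo.mem_nhds hs] with t ht htI
  -- `covDeriv` uses the chart at `γ t`; chart independence replaces it by the fixed chart at `γ s`.
  rw [SurfaceCurve.covDeriv,
    covDerivInChart_eq hIo hγ htI hV (mem_chart_source Plane (γ t)) ht,
    coord_covDerivInChart ht ((hV.coord_contDiffAt hIo hγ htI ht).differentiableAt (by simp))]

/-- The Levi-Civita connection is compatible with the metric. -/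
theorem hasDerivAt_inner_field (hIo : IsOpen I) (hγ : ContMDiffOn 𝓘(ℝ, ℝ) (𝓡 2) ∞ γ I)
    (hV : IsSmoothField γ I V) (hW : IsSmoothField γ I W) (hs : s ∈ I) :
    HasDerivAt (fun t => (inner ℝ (V t) (W t) : ℝ))
      (inner ℝ (covDeriv γ V s) (W s) + inner ℝ (V s) (covDeriv γ W s)) s := by
  have h₀ := mem_chart_source Plane (γ s)
  have dV := (hV.coord_contDiffAt hIo hγ hs h₀).differentiableAt (by simp)
  have dW := (hW.coord_contDiffAt hIo hγ hs h₀).differentiableAt (by simp)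
  have e1 : HasDerivAt (fun t => metricForm (γ s) (extChartAt (𝓡 2) (γ s) (γ t)))
      (fderiv ℝ (metricForm (γ s)) (extChartAt (𝓡 2) (γ s) (γ s))
        (coord (γ s) (γ s) (velocity γ s))) s :=
    hasDerivAt_comp_of_differentiableAt (E := Plane) (F := Plane →L[ℝ] Plane →L[ℝ] ℝ)
      (metricForm_differentiableAt (chart_mem_target h₀))
      (hasDerivAt_chart (mdifferentiableAt_curve hIo hγ hs) h₀)
  have e2 := (HasDerivAt.clm_apply (F := Plane) (G := Plane →L[ℝ] ℝ) e1
    dV.hasDerivAt).clm_apply dW.hasDerivAt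
  have hev : (fun t => (inner ℝ (V t) (W t) : ℝ)) =ᶠ[𝓝 s] fun t =>
      metricForm (γ s) (extChartAt (𝓡 2) (γ s) (γ t)) (coord (γ s) (γ t) (V t))
        (coord (γ s) (γ t) (W t)) := by
    filter_upwards [eventually_mem_source hIo hγ hs h₀] with t ht
    exact (metricForm_coord ht _ _).symm
  refine (e2.congr_of_eventuallyEq hev).congr_deriv ?_
  rw [← metricForm_coord h₀, ← metricForm_coord h₀, covDeriv, covDeriv,
    coord_covDerivInChart h₀ dV, coord_covDerivInChart h₀ dW, _root_.add_apply,
    fderiv_metricForm_eq (chart_mem_target h₀)]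
  simp only [map_add, _root_.add_apply]
  ring

theorem christoffelMap_add (p₀ : M) (x u v w : Plane) :
    christoffelMap p₀ x u (v + w) = christoffelMap p₀ x u v + christoffelMap p₀ x u w := by
  ext k
  simp only [christoffelMap, Fin.sum_univ_two, PiLp.add_apply]
  ring

theorem christoffelMap_smul (p₀ : M) (x u v : Plane) (a : ℝ) :
    christoffelMap p₀ x u (a • v) = a • christoffelMap p₀ x u v := by
  ext k
  simp only [christoffelMap, Fin.sum_univ_two, PiLp.smul_apply, smul_eq_mul]
  ring

theorem covDeriv_add (hIo : IsOpen I) (hγ : ContMDiffOn 𝓘(ℝ, ℝ) (𝓡 2) ∞ γ I)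
    (hV : IsSmoothField γ I V) (hW : IsSmoothField γ I W) (hs : s ∈ I) :
    covDeriv γ (fun t => V t + W t) s = covDeriv γ V s + covDeriv γ W s := by
  have h₀ := mem_chart_source Plane (γ s)
  have dV := (hV.coord_contDiffAt hIo hγ hs h₀).differentiableAt (by simp)
  have dW := (hW.coord_contDiffAt hIo hγ hs h₀).differentiableAt (by simp)
  have d := dV.hasDerivAt.add dW.hasDerivAt
  refine coord_injective h₀ ?_
  have e : (fun t => coord (γ s) (γ t) (V t + W t)) =
      (fun t => coord (γ s) (γ t) (V t)) + fun t => coord (γ s) (γ t) (W t) :=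
    funext fun t => coord_add _ _ _ _
  rw [coord_add, covDeriv, covDeriv, covDeriv,
    coord_covDerivInChart h₀ (by rw [e]; exact d.differentiableAt), coord_covDerivInChart h₀ dV,
    coord_covDerivInChart h₀ dW, e, d.deriv, coord_add, christoffelMap_add]
  abel

theorem covDeriv_smul (hIo : IsOpen I) (hγ : ContMDiffOn 𝓘(ℝ, ℝ) (𝓡 2) ∞ γ I)
    (hV : IsSmoothField γ I V) (hs : s ∈ I) {f : ℝ → ℝ} {f' : ℝ} (hf : HasDerivAt f f' s) :
    covDeriv γ (fun t => f t • V t) s = f' • V s + f s • covDeriv γ V s := by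
  have h₀ := mem_chart_source Plane (γ s)
  have dV := (hV.coord_contDiffAt hIo hγ hs h₀).differentiableAt (by simp)
  have d := hf.smul dV.hasDerivAt
  refine coord_injective h₀ ?_
  have e : (fun t => coord (γ s) (γ t) (f t • V t)) =
      f • fun t => coord (γ s) (γ t) (V t) :=
    funext fun t => coord_smul _ _ _ _
  rw [coord_add, coord_smul, coord_smul, covDeriv, covDeriv,
    coord_covDerivInChart h₀ (by rw [e]; exact d.differentiableAt), coord_covDerivInChart h₀ dV,
    e, d.deriv, coord_smul, christoffelMap_smul, smul_add]
  abel

theorem covDeriv_congr (hIo : IsOpen I) (h : ∀ t ∈ I, V t = W t) (hs : s ∈ I) :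
    covDeriv γ V s = covDeriv γ W s := by
  have hev : ∀ k, (fun t => coord (γ s) (γ t) (V t) k) =ᶠ[𝓝 s]
      fun t => coord (γ s) (γ t) (W t) k := fun k => by
    filter_upwards [hIo.mem_nhds hs] with t ht
    rw [h t ht]
  simp only [covDeriv, covDerivInChart, (hev _).deriv_eq, h s hs]

end CovariantDerivative

/-! ### Curvature tensor of a surface. -/

section Curvature

theorem pderiv_comm {f : Plane → ℝ} {x : Plane} (hf : ContDiffAt ℝ ∞ f x) (i j : Fin 2) :
    pderiv i (pderiv j f) x = pderiv j (pderiv i f) x := by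
  have hd : DifferentiableAt ℝ (fderiv ℝ f) x :=
    (hf.fderiv_right (m := ∞) (by simp)).differentiableAt (by simp)
  have h : ∀ a b : Fin 2, pderiv a (pderiv b f) x =
      fderiv ℝ (fderiv ℝ f) x (EuclideanSpace.single a 1) (EuclideanSpace.single b 1) := by
    intro a b
    have e := hd.hasFDerivAt.clm_apply
      (hasFDerivAt_const (EuclideanSpace.single b (1 : ℝ) : Plane) x)
    have e' := congrArg (fun L : Plane →L[ℝ] ℝ => L (EuclideanSpace.single a 1)) e.fderiv
    have e2 : fderiv ℝ (fun y => fderiv ℝ f y (EuclideanSpace.single b 1)) x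
        (EuclideanSpace.single a 1) = fderiv ℝ (fderiv ℝ f) x (EuclideanSpace.single a 1)
          (EuclideanSpace.single b 1) := by simpa using e'
    exact e2
  rw [h, h]
  exact (hf.isSymmSndFDerivAt (by simp; norm_cast)).eq _ _

theorem pderiv_add {f g : Plane → ℝ} {x : Plane} (hf : DifferentiableAt ℝ f x)
    (hg : DifferentiableAt ℝ g x) (i : Fin 2) :
    pderiv i (fun y => f y + g y) x = pderiv i f x + pderiv i g x := by
  simp only [pderiv, fderiv_fun_add hf hg, _root_.add_apply]

theorem pderiv_mul {f g : Plane → ℝ} {x : Plane} (hf : DifferentiableAt ℝ f x)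
    (hg : DifferentiableAt ℝ g x) (i : Fin 2) :
    pderiv i (fun y => f y * g y) x = pderiv i f x * g x + f x * pderiv i g x := by
  simp only [pderiv, fderiv_fun_mul hf hg, _root_.add_apply, _root_.smul_apply, smul_eq_mul]
  ring

theorem pderiv_congr {f g : Plane → ℝ} {x : Plane} (h : f =ᶠ[𝓝 x] g) (i : Fin 2) :
    pderiv i f x = pderiv i g x := by
  simp only [pderiv, h.fderiv_eq]

variable {M : Type*} [TopologicalSpace M] [ChartedSpace Plane M] [IsManifold (𝓡 2) ∞ M]
  [RiemannianBundle (fun x : M => TangentSpace (𝓡 2) x)]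

/-- The curvature coefficients with all indices lowered. -/
noncomputable def loweredCurvature (p₀ : M) (x : Plane) (i j k m : Fin 2) : ℝ :=
  ∑ l, riemannCoeff p₀ x l i j k * metricMatrix p₀ x l m

theorem loweredCurvature_swap (p₀ : M) (x : Plane) (i j k m : Fin 2) :
    loweredCurvature p₀ x i j k m = -loweredCurvature p₀ x j i k m := by
  simp only [loweredCurvature, riemannCoeff, Fin.sum_univ_two]
  ring

theorem inner_curvatureTensor (p : M) (u v w z : TangentSpace (𝓡 2) p) :
    inner ℝ (curvatureTensor p u v w) z = ∑ i, ∑ j, ∑ k, ∑ m,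
      loweredCurvature p (extChartAt (𝓡 2) p p) i j k m *
        (coord p p u i * coord p p v j * coord p p w k * coord p p z m) := by
  have h₀ := mem_chart_source Plane p
  rw [← metricForm_coord h₀, curvatureTensor, coord_sum_frame p p h₀, metricForm_apply]
  simp only [Fin.sum_univ_two, loweredCurvature]
  ring

variable [IsContMDiffRiemannianBundle (𝓡 2) ∞ Plane (fun x : M => TangentSpace (𝓡 2) x)]

/-- Metric compatibility in indices, by adding two Koszul identities. Differentiated once more, it
yields the skew-symmetry of the curvature operators. -/
theorem pderiv_metricMatrix {p₀ : M} {x : Plane} (hx : x ∈ (extChartAt (𝓡 2) p₀).target)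
    (j k m : Fin 2) : pderiv j (fun y => metricMatrix p₀ y k m) x =
      (christoffel p₀ x 0 j k * metricMatrix p₀ x 0 m
          + christoffel p₀ x 1 j k * metricMatrix p₀ x 1 m)
        + (christoffel p₀ x 0 j m * metricMatrix p₀ x 0 k
          + christoffel p₀ x 1 j m * metricMatrix p₀ x 1 k) := by
  have h1 := koszul_index hx j k m
  have h2 := koszul_index hx j m k
  have h : (fun y => metricMatrix p₀ y m k) = fun y => metricMatrix p₀ y k m :=
    funext fun y => metricMatrix_comm p₀ y m k
  rw [h] at h2
  simp only [Fin.sum_univ_two] at h1 h2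
  linarith

theorem pderiv_pderiv_metricMatrix {p₀ : M} {x : Plane}
    (hx : x ∈ (extChartAt (𝓡 2) p₀).target) (i j k m : Fin 2) :
    pderiv i (pderiv j fun y => metricMatrix p₀ y k m) x =
      ((pderiv i (fun y => christoffel p₀ y 0 j k) x * metricMatrix p₀ x 0 m
          + christoffel p₀ x 0 j k * pderiv i (fun y => metricMatrix p₀ y 0 m) x)
        + (pderiv i (fun y => christoffel p₀ y 1 j k) x * metricMatrix p₀ x 1 m
          + christoffel p₀ x 1 j k * pderiv i (fun y => metricMatrix p₀ y 1 m) x))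
      + ((pderiv i (fun y => christoffel p₀ y 0 j m) x * metricMatrix p₀ x 0 k
          + christoffel p₀ x 0 j m * pderiv i (fun y => metricMatrix p₀ y 0 k) x)
        + (pderiv i (fun y => christoffel p₀ y 1 j m) x * metricMatrix p₀ x 1 k
          + christoffel p₀ x 1 j m * pderiv i (fun y => metricMatrix p₀ y 1 k) x)) := by
  have hg : ∀ a b, DifferentiableAt ℝ (fun y => metricMatrix p₀ y a b) x := fun a b =>
    (metricMatrix_contDiffAt hx a b).differentiableAt (by simp)
  have hΓ : ∀ a b c, DifferentiableAt ℝ (fun y => christoffel p₀ y a b c) x := fun a b c =>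
    (christoffel_contDiffAt hx a b c).differentiableAt (by simp)
  have hm : ∀ a b c d, DifferentiableAt ℝ
      (fun y => christoffel p₀ y a b c * metricMatrix p₀ y a d) x := fun a b c d =>
    (hΓ a b c).mul (hg a d)
  rw [pderiv_congr (Filter.eventually_of_mem ((isOpen_target p₀).mem_nhds hx)
      fun y hy => pderiv_metricMatrix hy j k m),
    pderiv_add ((hm 0 j k m).fun_add (hm 1 j k m)) ((hm 0 j m k).fun_add (hm 1 j m k)),
    pderiv_add (hm 0 j k m) (hm 1 j k m), pderiv_add (hm 0 j m k) (hm 1 j m k),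
    pderiv_mul (hΓ 0 j k) (hg 0 m), pderiv_mul (hΓ 1 j k) (hg 1 m),
    pderiv_mul (hΓ 0 j m) (hg 0 k), pderiv_mul (hΓ 1 j m) (hg 1 k)]

/-- The curvature operators `R(u, v)` are skew-symmetric. -/
theorem loweredCurvature_skew {p₀ : M} {x : Plane} (hx : x ∈ (extChartAt (𝓡 2) p₀).target)
    (i j k m : Fin 2) :
    loweredCurvature p₀ x i j k m = -loweredCurvature p₀ x i j m k := by
  have h1 := pderiv_pderiv_metricMatrix hx i j k m
  have h2 := pderiv_pderiv_metricMatrix hx j i k m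
  -- Second partials of `g_km` commute, and the difference of their two expansions is `R_ijkm +
  -- R_ijmk`.
  rw [pderiv_comm (metricMatrix_contDiffAt hx k m) j i, h1] at h2
  simp only [pderiv_metricMatrix hx, metricMatrix_comm p₀ x 1 0] at h2
  simp only [loweredCurvature, riemannCoeff, Fin.sum_univ_two]
  linear_combination h2

/-- The curvature tensor of a surface. -/
theorem curvatureTensor_eq (p : M) (u v w : TangentSpace (𝓡 2) p) :
    curvatureTensor p u v w =
      gaussianCurvature p • ((inner ℝ v w : ℝ) • u - (inner ℝ u w : ℝ) • v) := by
  have h₀ := mem_chart_source Plane p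
  set x := extChartAt (𝓡 2) p p with hx
  have hx' : x ∈ (extChartAt (𝓡 2) p).target := chart_mem_target h₀
  have hdet := metricMatrix_det_ne_zero hx'
  rw [Matrix.det_fin_two] at hdet
  have hK : gaussianCurvature p * (metricMatrix p x 0 0 * metricMatrix p x 1 1
      - metricMatrix p x 0 1 * metricMatrix p x 1 0) = loweredCurvature p x 0 1 1 0 := by
    have h1 : inner ℝ (curvatureTensor p (frame p p 0) (frame p p 1) (frame p p 1))
        (frame p p 0) = loweredCurvature p x 0 1 1 0 := by
      rw [inner_curvatureTensor]
      simp [coord_frame p p h₀, hx]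
    have h2 : ‖frame p p 0‖ ^ 2 * ‖frame p p 1‖ ^ 2 - inner ℝ (frame p p 0) (frame p p 1) ^ 2 =
        metricMatrix p x 0 0 * metricMatrix p x 1 1
          - metricMatrix p x 0 1 * metricMatrix p x 1 0 := by
      rw [metricMatrix_comm p x 1 0]
      simp only [hx, metricMatrix_chart h₀, real_inner_self_eq_norm_sq]
      ring
    rw [gaussianCurvature, h1, h2]
    exact div_mul_cancel₀ _ hdet
  -- Skew-symmetry in each pair of indices leaves only `R_0110`, up to sign, and this is the
  -- Gaussian curvature times `det g`.
  have z : ∀ k m, loweredCurvature p x 0 0 k m = 0 := fun k m => by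
    linarith [loweredCurvature_swap p x 0 0 k m]
  have z' : ∀ k m, loweredCurvature p x 1 1 k m = 0 := fun k m => by
    linarith [loweredCurvature_swap p x 1 1 k m]
  have y : ∀ i j, loweredCurvature p x i j 0 0 = 0 := fun i j => by
    linarith [loweredCurvature_skew hx' i j 0 0]
  have y' : ∀ i j, loweredCurvature p x i j 1 1 = 0 := fun i j => by
    linarith [loweredCurvature_skew hx' i j 1 1]
  refine ext_inner_right ℝ fun t => ?_
  rw [inner_curvatureTensor, real_inner_smul_left, inner_sub_left, real_inner_smul_left,
    real_inner_smul_left]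
  simp only [← metricForm_coord h₀, metricForm_apply, ← hx,
    Fin.sum_univ_two, loweredCurvature_swap p x 1 0, loweredCurvature_skew hx' 0 1 0 1, ← hK,
    z, z', y, y']
  rw [metricMatrix_comm p x 1 0]
  ring

end Curvature

/-! ### The differential equations for the curvature. -/

section Ode

-- The coefficient of `k ^ 10` is `-126/25` whatever `K`, `c`, `d`, so the polynomial is never zero.
open Polynomial in
theorem finite_polynomial_zeros (K c d : ℝ) :
    {k : ℝ | -(126 / 25) * k ^ 10 - 8 / 5 * K * k ^ 8 - 63 / 5 * d * k ^ 6 + 84 / 5 * c * k ^ 5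
      + K * c * k ^ 3 + 6 * c * d * k - 14 * c ^ 2 = 0}.Finite := by
  set P : ℝ[X] := C (-(126 / 25)) * X ^ 10 - C (8 / 5 * K) * X ^ 8 - C (63 / 5 * d) * X ^ 6
    + C (84 / 5 * c) * X ^ 5 + C (K * c) * X ^ 3 + C (6 * c * d) * X - C (14 * c ^ 2) with hP
  have hne : P ≠ 0 := by
    intro h
    have h10 := congrArg (fun Q : ℝ[X] => Q.coeff 10) h
    simp only [hP, coeff_add, coeff_sub, coeff_C_mul, coeff_X_pow, coeff_X, coeff_C,
      coeff_zero] at h10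
    norm_num at h10
  refine (P.roots.toFinset.finite_toSet).subset fun k hk => ?_
  simp only [Finset.mem_coe, Multiset.mem_toFinset, mem_roots hne, IsRoot.def]
  simpa [hP] using hk

theorem constant_of_deriv_eq_zero {J : Set ℝ} (hJ : IsOpen J) (hJ' : IsPreconnected J)
    {f : ℝ → ℝ} (hf : ∀ t ∈ J, HasDerivAt f 0 t) {s t : ℝ} (hs : s ∈ J) (ht : t ∈ J) :
    f s = f t :=
  hJ.is_const_of_deriv_eq_zero hJ' (fun t ht => (hf t ht).differentiableAt.differentiableWithinAt)
    (fun t ht => (hf t ht).deriv) hs ht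

theorem deriv_eq_zero_of_constant {J : Set ℝ} (hJ : IsOpen J) {f f' : ℝ → ℝ} {a : ℝ}
    (hf : ∀ t ∈ J, HasDerivAt f (f' t) t) (hc : ∀ t ∈ J, f t = a) {t : ℝ} (ht : t ∈ J) :
    f' t = 0 := by
  have h : f =ᶠ[nhds t] fun _ => a := by
    filter_upwards [hJ.mem_nhds ht] with r hr using hc r hr
  exact (hf t ht).unique ((hasDerivAt_const t a).congr_of_eventuallyEq h)

/-- A nowhere vanishing solution on an interval of the two equations satisfied by the curvature of
a triharmonic curve is constant. -/
theorem curvature_constant {J : Set ℝ} (hJ : IsOpen J) (hJ' : IsPreconnected J) {K : ℝ}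
    {k k1 k2 k3 k4 : ℝ → ℝ} (h0 : ∀ t ∈ J, HasDerivAt k (k1 t) t)
    (h1 : ∀ t ∈ J, HasDerivAt k1 (k2 t) t) (h2 : ∀ t ∈ J, HasDerivAt k2 (k3 t) t)
    (h3 : ∀ t ∈ J, HasDerivAt k3 (k4 t) t)
    (hT : ∀ t ∈ J, 2 * k t ^ 3 * k1 t - 2 * k1 t * k2 t - k t * k3 t = 0)
    (hN : ∀ t ∈ J, k4 t - 10 * k t ^ 2 * k2 t - 15 * k t * k1 t ^ 2 + k t ^ 5 + K * k2 t
      - 2 * K * k t ^ 3 = 0)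
    (hk : ∀ t ∈ J, k t ≠ 0) {s t : ℝ} (hs : s ∈ J) (ht : t ∈ J) : k t = k s := by
  -- The derivative of the tangential equation, used below to eliminate `k4`.
  have hT' : ∀ t ∈ J, 6 * k t ^ 2 * k1 t ^ 2 + 2 * k t ^ 3 * k2 t - 2 * k2 t ^ 2
      - 3 * k1 t * k3 t - k t * k4 t = 0 := by
    intro t ht
    have e := ((((((h0 t ht).pow 3).const_mul 2).mul (h1 t ht))).sub
      (((h1 t ht).const_mul 2).mul (h2 t ht))).sub ((h0 t ht).mul (h3 t ht))
    have e' : HasDerivAt (fun t => 2 * k t ^ 3 * k1 t - 2 * k1 t * k2 t - k t * k3 t) _ t := e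
    have hev : (fun t => 2 * k t ^ 3 * k1 t - 2 * k1 t * k2 t - k t * k3 t)
        =ᶠ[nhds t] fun _ => 0 := by
      filter_upwards [hJ.mem_nhds ht] with r hr using hT r hr
    have u := e'.unique ((hasDerivAt_const t (0 : ℝ)).congr_of_eventuallyEq hev)
    simp only [Pi.pow_apply] at u
    norm_num at u
    linear_combination u
  -- First integral: `-k` times the tangential equation is an exact derivative.
  set c : ℝ := k s ^ 2 * k2 s - 2 / 5 * k s ^ 5 with hc
  have hC : ∀ t ∈ J, c = k t ^ 2 * k2 t - 2 / 5 * k t ^ 5 := by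
    intro t ht
    refine constant_of_deriv_eq_zero (f := fun t => k t ^ 2 * k2 t - 2 / 5 * k t ^ 5) hJ hJ'
      (fun r hr => ?_) hs ht
    have e := (((h0 r hr).pow 2).mul (h2 r hr)).sub (((h0 r hr).pow 5).const_mul (2 / 5))
    refine e.congr_deriv ?_
    simp only [Pi.pow_apply]
    norm_num
    linear_combination -k r * hT r hr
  -- Second integral: solve the first for `k'' = c/k² + (2/5)k³`, multiply by `2k'` and integrate.
  set d : ℝ := k1 s ^ 2 - 1 / 5 * k s ^ 4 + 2 * c * (k s)⁻¹ with hd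
  have hD : ∀ t ∈ J, d = k1 t ^ 2 - 1 / 5 * k t ^ 4 + 2 * c * (k t)⁻¹ := by
    intro t ht
    refine constant_of_deriv_eq_zero
      (f := fun t => k1 t ^ 2 - 1 / 5 * k t ^ 4 + 2 * c * (k t)⁻¹) hJ hJ' (fun r hr => ?_) hs ht
    have e := (((h1 r hr).pow 2).sub (((h0 r hr).pow 4).const_mul (1 / 5))).add
      (((h0 r hr).inv (hk r hr)).const_mul (2 * c))
    refine e.congr_deriv ?_
    have hr0 := hk r hr
    rw [hC r hr]
    norm_num
    field_simp
    ring
  have hP : ∀ t ∈ J, -(126 / 25) * k t ^ 10 - 8 / 5 * K * k t ^ 8 - 63 / 5 * d * k t ^ 6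
      + 84 / 5 * c * k t ^ 5 + K * c * k t ^ 3 + 6 * c * d * k t - 14 * c ^ 2 = 0 := by
    intro t ht
    have hdk : d * k t = k t * k1 t ^ 2 - 1 / 5 * k t ^ 5 + 2 * c := by
      have := hk t ht
      rw [hD t ht]
      field_simp
    have e : -(126 / 25) * k t ^ 10 - 8 / 5 * K * k t ^ 8 + 84 / 5 * c * k t ^ 5
        + K * c * k t ^ 3 - 14 * c ^ 2 + (6 * c - 63 / 5 * k t ^ 5) *
          (k t * k1 t ^ 2 - 1 / 5 * k t ^ 5 + 2 * c) = 0 := by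
      rw [hC t ht]
      -- The multiplier of `hT'` removes `k4`, that of `hT` removes `k3`; `k2` enters through `c`,
      -- and `k1 ^ 2` is then replaced using `d`.
      linear_combination k t ^ 5 * hN t ht + k t ^ 4 * hT' t ht - 3 * k t ^ 3 * k1 t * hT t ht
    linear_combination e + (6 * c - 63 / 5 * k t ^ 5) * hdk
  have hcont : ContinuousOn k J := fun r hr => (h0 r hr).continuousAt.continuousWithinAt
  by_contra hne
  -- A connected subset of the line with two points is infinite, whereas all values of `k` are roots
  -- of one polynomial.
  have hnt : (k '' J).Nontrivial := ⟨_, ⟨t, ht, rfl⟩, _, ⟨s, hs, rfl⟩, hne⟩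
  exact (hJ'.image k hcont).infinite_of_nontrivial hnt
    ((finite_polynomial_zeros K c d).subset (by rintro _ ⟨r, hr, rfl⟩; exact hP r hr))

/-- The two equations satisfied by the curvature of a triharmonic curve force
`k ^ 5 = 2 * K * k ^ 3`. -/
theorem curvature_pow_five {J : Set ℝ} (hJ : IsOpen J) {K : ℝ}
    {k k1 k2 k3 k4 : ℝ → ℝ} (h0 : ∀ t ∈ J, HasDerivAt k (k1 t) t)
    (h1 : ∀ t ∈ J, HasDerivAt k1 (k2 t) t) (h2 : ∀ t ∈ J, HasDerivAt k2 (k3 t) t)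
    (h3 : ∀ t ∈ J, HasDerivAt k3 (k4 t) t)
    (hT : ∀ t ∈ J, 2 * k t ^ 3 * k1 t - 2 * k1 t * k2 t - k t * k3 t = 0)
    (hN : ∀ t ∈ J, k4 t - 10 * k t ^ 2 * k2 t - 15 * k t * k1 t ^ 2 + k t ^ 5 + K * k2 t
      - 2 * K * k t ^ 3 = 0) {s : ℝ} (hs : s ∈ J) : k s ^ 5 = 2 * K * k s ^ 3 := by
  by_cases hk : k s = 0
  · simp [hk]
  -- On a ball around `s` where `k ≠ 0`, `k` is constant; its derivatives vanish there and only the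
  -- algebraic terms of the normal equation survive.
  obtain ⟨ε, hε, hB⟩ := Metric.eventually_nhds_iff_ball.1
    (((h0 s hs).continuousAt.eventually_ne hk).and (hJ.mem_nhds hs))
  set B := Metric.ball s ε
  have hBo : IsOpen B := Metric.isOpen_ball
  have hBc : IsPreconnected B := (convex_ball s ε).isPreconnected
  have hsB : s ∈ B := Metric.mem_ball_self hε
  have hBJ : ∀ t ∈ B, t ∈ J := fun t ht => (hB t ht).2
  have c0 : ∀ t ∈ B, k t = k s := fun t ht =>
    curvature_constant hBo hBc (fun t ht => h0 t (hBJ t ht)) (fun t ht => h1 t (hBJ t ht))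
      (fun t ht => h2 t (hBJ t ht)) (fun t ht => h3 t (hBJ t ht)) (fun t ht => hT t (hBJ t ht))
      (fun t ht => hN t (hBJ t ht)) (fun t ht => (hB t ht).1) hsB ht
  have c1 : ∀ t ∈ B, k1 t = 0 := fun t ht =>
    deriv_eq_zero_of_constant hBo (fun t ht => h0 t (hBJ t ht)) c0 ht
  have c2 : ∀ t ∈ B, k2 t = 0 := fun t ht =>
    deriv_eq_zero_of_constant hBo (fun t ht => h1 t (hBJ t ht)) c1 ht
  have c3 : ∀ t ∈ B, k3 t = 0 := fun t ht =>
    deriv_eq_zero_of_constant hBo (fun t ht => h2 t (hBJ t ht)) c2 ht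
  have c4 : k4 s = 0 := deriv_eq_zero_of_constant hBo (fun t ht => h3 t (hBJ t ht)) c3 hsB
  have h := hN s hs
  rw [c4, c1 s hsB, c2 s hsB] at h
  linear_combination h

end Ode

/-! ### Orthonormal pairs in a plane. -/

section LinearAlgebra

variable {E : Type*} [NormedAddCommGroup E] [InnerProductSpace ℝ E]

theorem exists_unit_orthogonal (hE : Module.finrank ℝ E = 2) {u : E} (hu : ‖u‖ = 1) :
    ∃ v : E, ‖v‖ = 1 ∧ inner ℝ u v = (0 : ℝ) := by
  have : Fact (Module.finrank ℝ E = 1 + 1) := ⟨hE⟩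
  have hu0 : u ≠ 0 := by
    rintro rfl
    simp at hu
  have h1 := Submodule.finrank_orthogonal_span_singleton (𝕜 := ℝ) (n := 1) hu0
  have : Nontrivial (Submodule.span ℝ {u})ᗮ :=
    Module.nontrivial_of_finrank_pos (R := ℝ) (h1 ▸ Nat.one_pos)
  obtain ⟨w, hw⟩ := exists_ne (0 : (Submodule.span ℝ {u})ᗮ)
  have hw0 : (w : E) ≠ 0 := by simpa using hw
  refine ⟨(‖(w : E)‖)⁻¹ • (w : E), norm_smul_inv_norm hw0, ?_⟩
  rw [real_inner_smul_right, Submodule.mem_orthogonal_singleton_iff_inner_right.1 w.2, mul_zero]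

theorem eq_orthonormal_expansion (hE : Module.finrank ℝ E = 2) {u v : E} (hu : ‖u‖ = 1)
    (hv : ‖v‖ = 1) (huv : inner ℝ u v = (0 : ℝ)) (w : E) :
    w = (inner ℝ u w : ℝ) • u + (inner ℝ v w : ℝ) • v := by
  have : FiniteDimensional ℝ E := FiniteDimensional.of_finrank_pos (by omega)
  have ho : Orthonormal ℝ ![u, v] := by
    constructor
    · intro i
      fin_cases i <;> simp [hu, hv]
    · intro i j hij
      fin_cases i <;> fin_cases j <;> simp_all [real_inner_comm]
  have hc : Fintype.card (Fin 2) = Module.finrank ℝ E := by simp [hE]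
  set b := basisOfOrthonormalOfCardEqFinrank ho hc with hb
  have hb' : Orthonormal ℝ b := by
    rw [hb, coe_basisOfOrthonormalOfCardEqFinrank]
    exact ho
  have h := (b.toOrthonormalBasis hb').sum_repr' w
  simpa [Fin.sum_univ_two, hb] using h.symm

end LinearAlgebra

/-! ### Frenet equations and triharmonic curves. -/

section Curves

variable {M : Type*} [TopologicalSpace M] [ChartedSpace Plane M] [IsManifold (𝓡 2) ∞ M]
  [RiemannianBundle (fun x : M => TangentSpace (𝓡 2) x)]

theorem finrank_tangentSpace (q : M) : Module.finrank ℝ (TangentSpace (𝓡 2) q) = 2 :=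
  finrank_euclideanSpace_fin (𝕜 := ℝ) (n := 2)

variable [IsContMDiffRiemannianBundle (𝓡 2) ∞ Plane (fun x : M => TangentSpace (𝓡 2) x)]

variable {γ : ℝ → M} {I J : Set ℝ} {V W N : ∀ s, TangentSpace (𝓡 2) (γ s)} {s : ℝ}

theorem IsSmoothField.inner (hV : IsSmoothField γ I V) (hW : IsSmoothField γ I W) :
    ContDiffOn ℝ ∞ (fun t => (inner ℝ (V t) (W t) : ℝ)) I := by
  rw [← contMDiffOn_iff_contDiffOn]
  exact ContMDiffOn.inner_bundle (F := Plane) hV hW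

/-- A vector at a point of a curve extends to a smooth field along the curve. -/
theorem exists_smooth_extension (hIo : IsOpen I) (hγ : ContMDiffOn 𝓘(ℝ, ℝ) (𝓡 2) ∞ γ I)
    (hs : s ∈ I) (w : TangentSpace (𝓡 2) (γ s)) :
    ∃ J : Set ℝ, IsOpen J ∧ s ∈ J ∧ J ⊆ I ∧ ∃ W : ∀ t, TangentSpace (𝓡 2) (γ t),
      IsSmoothField γ J W ∧ W s = w := by
  have h₀ := mem_chart_source Plane (γ s)
  have hJo : IsOpen (I ∩ γ ⁻¹' (chartAt Plane (γ s)).source) :=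
    hγ.continuousOn.isOpen_inter_preimage hIo (chartAt Plane (γ s)).open_source
  -- The extension has constant components in the chart at `γ s`, on the part of `I` mapped into
  -- that chart.
  refine ⟨_, hJo, ⟨hs, h₀⟩, inter_subset_left,
    fun t => ∑ k, coord (γ s) (γ s) w k • frame (γ s) (γ t) k, fun t ht => ?_,
    frame_coord_sum _ _ h₀ w⟩
  refine ((contMDiffAt_field_iff hIo hγ ht.1 ht.2).2 ?_).contMDiffWithinAt
  refine (contDiffAt_const (c := coord (γ s) (γ s) w)).congr_of_eventuallyEq ?_
  filter_upwards [hJo.mem_nhds ht] with r hr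
  exact coord_sum_frame _ _ hr.2 _

/-- Gram–Schmidt: extend a unit vector orthogonal to `T` at `s`, subtract its tangential part, and
normalize where the result is nonzero. -/
theorem exists_local_unit_normal (hIo : IsOpen I) (hγ : IsArcLengthCurve γ I) (hs : s ∈ I) :
    ∃ J : Set ℝ, IsOpen J ∧ s ∈ J ∧ J ⊆ I ∧ ∃ N : ∀ t, TangentSpace (𝓡 2) (γ t),
      IsUnitNormal γ J N := by
  obtain ⟨w, hw, hTw⟩ := exists_unit_orthogonal (finrank_tangentSpace (γ s))
    (hγ.norm_velocity s hs)
  obtain ⟨J, hJo, hsJ, hJI, W, hW, rfl⟩ := exists_smooth_extension hIo hγ.smooth hs w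
  have hγJ := hγ.smooth.mono hJI
  have hT := isSmoothField_velocity hJo hγJ
  have hTW : ContDiffOn ℝ ∞ (fun t => -(inner ℝ (velocity γ t) (W t) : ℝ)) J :=
    (hT.inner hW).neg
  have hY := hW.add hJo hγJ (hT.smul hJo hγJ hTW)
  set Y : ∀ t, TangentSpace (𝓡 2) (γ t) := fun t =>
    W t + (-(inner ℝ (velocity γ t) (W t) : ℝ)) • velocity γ t with hYdef
  have hYs : Y s = W s := by
    simp only [hYdef, hTw, neg_zero, zero_smul, add_zero]
  have hYY := hY.inner hY
  refine ⟨J ∩ (fun t => (inner ℝ (Y t) (Y t) : ℝ)) ⁻¹' {0}ᶜ,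
    hYY.continuousOn.isOpen_inter_preimage hJo isOpen_compl_singleton, ⟨hsJ, ?_⟩,
    fun t ht => hJI ht.1, fun t => (√(inner ℝ (Y t) (Y t) : ℝ))⁻¹ • Y t, ?_, ?_, ?_⟩
  · simp only [mem_preimage, mem_compl_iff, mem_singleton_iff, hYs]
    rw [real_inner_self_eq_norm_sq, hw]
    norm_num
  · have hJ'o := hYY.continuousOn.isOpen_inter_preimage hJo
      (isOpen_compl_singleton (x := (0 : ℝ)))
    refine (hY.mono inter_subset_left).smul hJ'o (hγJ.mono inter_subset_left) ?_
    refine ((hYY.mono inter_subset_left).sqrt fun t ht => ht.2).inv fun t ht => ?_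
    have h0 : (inner ℝ (Y t) (Y t) : ℝ) ≠ 0 := ht.2
    exact (Real.sqrt_pos.2 (lt_of_le_of_ne real_inner_self_nonneg h0.symm)).ne'
  · intro t ht
    have h0 : (inner ℝ (Y t) (Y t) : ℝ) ≠ 0 := ht.2
    rw [← norm_eq_sqrt_real_inner]
    exact norm_smul_inv_norm fun h => h0 (by rw [h, inner_zero_left])
  · intro t ht
    have h1 := hγ.norm_velocity t (hJI ht.1)
    have h2 : (inner ℝ (velocity γ t) (Y t) : ℝ) = 0 := by
      simp only [hYdef, inner_add_right, real_inner_smul_right, real_inner_self_eq_norm_sq, h1]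
      ring
    rw [real_inner_smul_right, h2, mul_zero]

/-- Differentiate `⟨T, T⟩ = 1`. -/
theorem inner_covDeriv_velocity (hIo : IsOpen I) (hγ : IsArcLengthCurve γ I) (hs : s ∈ I) :
    inner ℝ (velocity γ s) (covDeriv γ (velocity γ) s) = (0 : ℝ) := by
  have hT := isSmoothField_velocity hIo hγ.smooth
  have h := hasDerivAt_inner_field hIo hγ.smooth hT hT hs
  have h2 := h.unique ((hasDerivAt_const s (1 : ℝ)).congr_of_eventuallyEq (by
    filter_upwards [hIo.mem_nhds hs] with t ht
    rw [real_inner_self_eq_norm_sq, hγ.norm_velocity t ht, one_pow]))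
  rw [real_inner_comm] at h2
  linarith

/-- The first Frenet equation. -/
theorem covDeriv_velocity_eq (hIo : IsOpen I) (hγ : IsArcLengthCurve γ I)
    (hN : IsUnitNormal γ I N) (hs : s ∈ I) :
    covDeriv γ (velocity γ) s = geodesicCurvature γ N s • N s := by
  have h := eq_orthonormal_expansion (finrank_tangentSpace (γ s)) (hγ.norm_velocity s hs)
    (hN.norm_eq_one s hs) (hN.orthogonal s hs) (covDeriv γ (velocity γ) s)
  rw [inner_covDeriv_velocity hIo hγ hs, zero_smul, zero_add] at h
  rw [geodesicCurvature, real_inner_comm]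
  exact h

/-- The second Frenet equation. -/
theorem covDeriv_normal_eq (hIo : IsOpen I) (hγ : IsArcLengthCurve γ I)
    (hN : IsUnitNormal γ I N) (hs : s ∈ I) :
    covDeriv γ N s = -geodesicCurvature γ N s • velocity γ s := by
  have hT := isSmoothField_velocity hIo hγ.smooth
  have hNN := hasDerivAt_inner_field hIo hγ.smooth hN.smooth hN.smooth hs
  have h1 := hNN.unique ((hasDerivAt_const s (1 : ℝ)).congr_of_eventuallyEq (by
    filter_upwards [hIo.mem_nhds hs] with t ht
    rw [real_inner_self_eq_norm_sq, hN.norm_eq_one t ht, one_pow]))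
  have hTN := hasDerivAt_inner_field hIo hγ.smooth hT hN.smooth hs
  have h2 := hTN.unique ((hasDerivAt_const s (0 : ℝ)).congr_of_eventuallyEq (by
    filter_upwards [hIo.mem_nhds hs] with t ht
    exact hN.orthogonal t ht))
  have h := eq_orthonormal_expansion (finrank_tangentSpace (γ s)) (hγ.norm_velocity s hs)
    (hN.norm_eq_one s hs) (hN.orthogonal s hs) (covDeriv γ N s)
  rw [real_inner_comm] at h1
  have h3 : (inner ℝ (N s) (covDeriv γ N s) : ℝ) = 0 := by linarith
  have h4 : (inner ℝ (velocity γ s) (covDeriv γ N s) : ℝ) = -geodesicCurvature γ N s := by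
    rw [geodesicCurvature]
    linarith
  rwa [h3, h4, zero_smul, add_zero] at h

/-- Covariant derivative of a field expressed in the Frenet frame. -/
theorem covDeriv_frenet (hIo : IsOpen I) (hγ : IsArcLengthCurve γ I) (hN : IsUnitNormal γ I N)
    {a b a' b' : ℝ → ℝ} (ha : ContDiffOn ℝ ∞ a I) (hb : ContDiffOn ℝ ∞ b I)
    (ha' : ∀ t ∈ I, HasDerivAt a (a' t) t) (hb' : ∀ t ∈ I, HasDerivAt b (b' t) t)
    (hV : ∀ t ∈ I, V t = a t • velocity γ t + b t • N t) :
    ∀ t ∈ I, covDeriv γ V t = (a' t - b t * geodesicCurvature γ N t) • velocity γ t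
      + (b' t + a t * geodesicCurvature γ N t) • N t := by
  intro t ht
  have hT := isSmoothField_velocity hIo hγ.smooth
  have hN' : IsSmoothField γ I N := hN.smooth
  rw [covDeriv_congr hIo hV ht, covDeriv_add hIo hγ.smooth (hT.smul hIo hγ.smooth ha)
    (hN'.smul hIo hγ.smooth hb) ht, covDeriv_smul hIo hγ.smooth hT ht (ha' t ht),
    covDeriv_smul hIo hγ.smooth hN' ht (hb' t ht), covDeriv_velocity_eq hIo hγ hN ht,
    covDeriv_normal_eq hIo hγ hN ht]
  module

theorem covDerivVelocity_succ (γ : ℝ → M) (n : ℕ) :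
    covDerivVelocity γ (n + 1) = covDeriv γ (covDerivVelocity γ n) :=
  Function.iterate_succ_apply' _ _ _

theorem hasDerivAt_deriv_of_contDiffOn {f : ℝ → ℝ} (hIo : IsOpen I) (hf : ContDiffOn ℝ ∞ f I) :
    ContDiffOn ℝ ∞ (deriv f) I ∧ ∀ t ∈ I, HasDerivAt f (deriv f t) t :=
  ⟨hf.deriv_of_isOpen hIo (by simp), fun _ ht =>
    ((hf.contDiffAt (hIo.mem_nhds ht)).differentiableAt (by simp)).hasDerivAt⟩

/-- The geodesic curvature of a triharmonic curve in a surface of constant curvature. -/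
theorem geodesicCurvature_pow_five {K : ℝ} (hK : ∀ p : M, gaussianCurvature p = K)
    (hIo : IsOpen I) (hγ : IsTriharmonicCurve γ I) (hN : IsUnitNormal γ I N) (hs : s ∈ I) :
    geodesicCurvature γ N s ^ 5 = 2 * K * geodesicCurvature γ N s ^ 3 := by
  have hγ' := hγ.toIsArcLengthCurve
  have hT := isSmoothField_velocity hIo hγ.smooth
  have hN' : IsSmoothField γ I N := hN.smooth
  have s0 : ContDiffOn ℝ ∞ (geodesicCurvature γ N) I :=
    (hT.covDeriv hIo hγ.smooth).inner hN'
  set k := geodesicCurvature γ N with hk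
  obtain ⟨s1, d0⟩ := hasDerivAt_deriv_of_contDiffOn hIo s0
  set k1 := deriv k
  obtain ⟨s2, d1⟩ := hasDerivAt_deriv_of_contDiffOn hIo s1
  set k2 := deriv k1
  obtain ⟨s3, d2⟩ := hasDerivAt_deriv_of_contDiffOn hIo s2
  set k3 := deriv k2
  obtain ⟨-, d3⟩ := hasDerivAt_deriv_of_contDiffOn hIo s3
  set k4 := deriv k3
  have e1 : ∀ t ∈ I, covDerivVelocity γ 1 t = (0 : ℝ) • velocity γ t + k t • N t := by
    intro t ht
    rw [zero_smul, zero_add]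
    exact covDeriv_velocity_eq hIo hγ' hN ht
  have e2 := covDeriv_frenet hIo hγ' hN contDiffOn_const s0
    (fun t _ => hasDerivAt_const t (0 : ℝ)) d0 e1
  rw [← covDerivVelocity_succ, ← hk] at e2
  have e2' : ∀ t ∈ I, covDerivVelocity γ 2 t =
      (-(k t ^ 2)) • velocity γ t + k1 t • N t := fun t ht => by
    rw [e2 t ht]
    module
  have e3 := covDeriv_frenet hIo hγ' hN (a := fun t => -(k t ^ 2)) (b := k1)
    (a' := fun t => -(2 * k t * k1 t)) (b' := k2) (by fun_prop) (by fun_prop)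
    (fun t ht => ((d0 t ht).pow 2).neg.congr_deriv (by norm_num)) d1 e2'
  rw [← covDerivVelocity_succ, ← hk] at e3
  have e3' : ∀ t ∈ I, covDerivVelocity γ 3 t =
      (-(3 * k t * k1 t)) • velocity γ t + (k2 t - k t ^ 3) • N t := fun t ht => by
    rw [e3 t ht]
    module
  have e4 := covDeriv_frenet hIo hγ' hN (a := fun t => -(3 * k t * k1 t))
    (b := fun t => k2 t - k t ^ 3) (a' := fun t => -(3 * k1 t ^ 2 + 3 * k t * k2 t))
    (b' := fun t => k3 t - 3 * k t ^ 2 * k1 t) (by fun_prop) (by fun_prop)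
    (fun t ht => (((d0 t ht).const_mul 3).mul (d1 t ht)).neg.congr_deriv (by ring))
    (fun t ht => ((d2 t ht).sub ((d0 t ht).pow 3)).congr_deriv (by norm_num)) e3'
  rw [← covDerivVelocity_succ, ← hk] at e4
  have e4' : ∀ t ∈ I, covDerivVelocity γ 4 t =
      (k t ^ 4 - 4 * (k t * k2 t) - 3 * k1 t ^ 2) • velocity γ t
        + (k3 t - 6 * (k t ^ 2 * k1 t)) • N t := fun t ht => by
    rw [e4 t ht]
    module
  have e5 := covDeriv_frenet hIo hγ' hN
    (a := fun t => k t ^ 4 - 4 * (k t * k2 t) - 3 * k1 t ^ 2)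
    (b := fun t => k3 t - 6 * (k t ^ 2 * k1 t))
    (a' := fun t => 4 * k t ^ 3 * k1 t - 4 * (k1 t * k2 t + k t * k3 t) - 6 * k1 t * k2 t)
    (b' := fun t => k4 t - 6 * (2 * k t * k1 t * k1 t + k t ^ 2 * k2 t))
    (by fun_prop) (by fun_prop)
    (fun t ht => ((((d0 t ht).pow 4).sub (((d0 t ht).mul (d2 t ht)).const_mul 4)).sub
      (((d1 t ht).pow 2).const_mul 3)).congr_deriv (by norm_num; ring))
    (fun t ht => ((d3 t ht).sub ((((d0 t ht).pow 2).mul (d1 t ht)).const_mul 6)).congr_deriv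
      (by norm_num)) e4'
  rw [← covDerivVelocity_succ, ← hk] at e5
  have key : ∀ t ∈ I,
      10 * k t ^ 3 * k1 t - 10 * k1 t * k2 t - 5 * k t * k3 t = 0 ∧
      k4 t - 10 * k t ^ 2 * k2 t - 15 * k t * k1 t ^ 2 + k t ^ 5 + K * k2 t
        - 2 * K * k t ^ 3 = 0 := by
    intro t ht
    have hTT : (inner ℝ (velocity γ t) (velocity γ t) : ℝ) = 1 := by
      rw [real_inner_self_eq_norm_sq, hγ.norm_velocity t ht, one_pow]
    have hNN : (inner ℝ (N t) (N t) : ℝ) = 1 := by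
      rw [real_inner_self_eq_norm_sq, hN.norm_eq_one t ht, one_pow]
    have hTN : (inner ℝ (velocity γ t) (N t) : ℝ) = 0 := hN.orthogonal t ht
    have hNT : (inner ℝ (N t) (velocity γ t) : ℝ) = 0 := by rw [real_inner_comm, hTN]
    have h := hγ.tension_eq_zero t ht
    -- The curvature terms are purely normal: `R(∇_T³T, T)T = K (k2 - k³) N` and `R(∇_T²T, ∇_T T)T =
    -- K k³ N`, whence `K k2 - 2K k³`.
    rw [tension₃, e5 t ht, curvatureTensor_eq, curvatureTensor_eq, hK, e1 t ht, e2' t ht,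
      e3' t ht] at h
    constructor
    · have hT := congrArg (fun v => (inner ℝ (velocity γ t) v : ℝ)) h
      simp only [inner_add_left, inner_add_right, inner_sub_right, real_inner_smul_left,
        real_inner_smul_right, hTT, hTN, hNT, inner_zero_right] at hT
      linear_combination hT
    · have hT := congrArg (fun v => (inner ℝ (N t) v : ℝ)) h
      simp only [inner_add_left, inner_add_right, inner_sub_right, real_inner_smul_left,
        real_inner_smul_right, hTT, hNN, hNT, inner_zero_right] at hT
      linear_combination hT
  exact curvature_pow_five hIo d0 d1 d2 d3
    (fun t ht => by linear_combination (1 / 5) * (key t ht).1) (fun t ht => (key t ht).2) hs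

/-- The squared acceleration equals `k²` for any unit normal, so a local normal near `s` suffices
and no sign has to be matched. -/
theorem sq_norm_acceleration {K : ℝ} (hK : ∀ p : M, gaussianCurvature p = K)
    (hIo : IsOpen I) (hγ : IsTriharmonicCurve γ I) (hs : s ∈ I) :
    (inner ℝ (covDeriv γ (velocity γ) s) (covDeriv γ (velocity γ) s) : ℝ) = 0 ∨
      (inner ℝ (covDeriv γ (velocity γ) s) (covDeriv γ (velocity γ) s) : ℝ) = 2 * K := by
  obtain ⟨J, hJo, hsJ, hJI, N, hN⟩ := exists_local_unit_normal hIo hγ.toIsArcLengthCurve hs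
  have hγJ : IsTriharmonicCurve γ J :=
    ⟨⟨hγ.smooth.mono hJI, fun t ht => hγ.norm_velocity t (hJI ht)⟩,
      fun t ht => hγ.tension_eq_zero t (hJI ht)⟩
  have h := geodesicCurvature_pow_five hK hJo hγJ hN hsJ
  have hA := covDeriv_velocity_eq hJo hγJ.toIsArcLengthCurve hN hsJ
  have hq : (inner ℝ (covDeriv γ (velocity γ) s) (covDeriv γ (velocity γ) s) : ℝ) =
      geodesicCurvature γ N s ^ 2 := by
    rw [hA, real_inner_smul_left, real_inner_smul_right, real_inner_self_eq_norm_sq,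
      hN.norm_eq_one s hsJ]
    ring
  rw [hq]
  by_cases h0 : geodesicCurvature γ N s = 0
  · left
    rw [h0]
    norm_num
  · right
    apply mul_left_cancel₀ (pow_ne_zero 3 h0)
    linear_combination h

end Curves

end SurfaceCurve

/-! ### The classification of triharmonic curves. -/

theorem mainTheorem3 {M : Type*} [TopologicalSpace M] [ChartedSpace SurfaceCurve.Plane M]
    [IsManifold (𝓡 2) ∞ M] [RiemannianBundle (fun x : M => TangentSpace (𝓡 2) x)]
    [IsContMDiffRiemannianBundle (𝓡 2) ∞ SurfaceCurve.Plane
      (fun x : M => TangentSpace (𝓡 2) x)]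
    (K : ℝ) (hK : ∀ p : M, SurfaceCurve.gaussianCurvature p = K)
    (I : Set ℝ) (hIo : IsOpen I) (hIc : I.OrdConnected)
    (γ : ℝ → M) (hγ : SurfaceCurve.IsTriharmonicCurve γ I) :
    (K ≤ 0 → SurfaceCurve.IsGeodesic γ I) ∧
      (0 < K → SurfaceCurve.IsGeodesic γ I ∨
        ∃ κ : ℝ, κ ^ 2 = 2 * K ∧ SurfaceCurve.IsCircle γ I κ) := by
  have hq := fun s (hs : s ∈ I) => SurfaceCurve.sq_norm_acceleration hK hIo hγ hs
  have hA := (SurfaceCurve.isSmoothField_velocity hIo hγ.smooth).covDeriv hIo hγ.smooth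
  refine ⟨fun hK0 s hs => ?_, fun hK0 => ?_⟩
  · rcases hq s hs with h | h
    · exact inner_self_eq_zero.1 h
    · have h' : 0 ≤ 2 * K := h ▸ real_inner_self_nonneg
      exact inner_self_eq_zero.1 (h.trans (le_antisymm (by linarith) h'))
  · by_cases hg : SurfaceCurve.IsGeodesic γ I
    · exact Or.inl hg
    right
    unfold SurfaceCurve.IsGeodesic at hg
    push Not at hg
    obtain ⟨s, hs, hne⟩ := hg
    have hs2 := (hq s hs).resolve_left fun h => hne (inner_self_eq_zero.1 h)
    -- The squared acceleration is continuous on an interval with values in `{0, 2K}`, two distinct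
    -- numbers since `K > 0`; being `2K` at `s`, it is `2K` everywhere.
    have hall : ∀ t ∈ I, (inner ℝ (SurfaceCurve.covDeriv γ (SurfaceCurve.velocity γ) t)
        (SurfaceCurve.covDeriv γ (SurfaceCurve.velocity γ) t) : ℝ) = 2 * K := by
      intro t ht
      refine (hq t ht).resolve_left fun h0 => ?_
      have hpre := hIc.isPreconnected.image _ (hA.inner hA).continuousOn
      refine hpre.infinite_of_nontrivial ⟨_, ⟨s, hs, rfl⟩, _, ⟨t, ht, rfl⟩, ?_⟩
        (((finite_singleton (2 * K)).insert 0).subset ?_)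
      · simp only [hs2, h0]
        positivity
      · rintro _ ⟨r, hr, rfl⟩
        exact hq r hr
    have hpos : 0 < √(2 * K) := Real.sqrt_pos.2 (by positivity)
    have hsq : √(2 * K) ^ 2 = 2 * K := Real.sq_sqrt (by positivity)
    -- The normal is the acceleration divided by its constant length `√(2K)`, which makes the
    -- geodesic curvature equal to that length.
    refine ⟨√(2 * K), hsq, hpos.ne',
      fun t => (√(2 * K))⁻¹ • SurfaceCurve.covDeriv γ (SurfaceCurve.velocity γ) t,
      ⟨hA.smul hIo hγ.smooth contDiffOn_const, fun t ht => ?_, fun t ht => ?_⟩, fun t ht => ?_⟩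
    · have hn : ‖SurfaceCurve.covDeriv γ (SurfaceCurve.velocity γ) t‖ = √(2 * K) := by
        rw [norm_eq_sqrt_real_inner, hall t ht]
      rw [norm_smul, hn, norm_inv, Real.norm_of_nonneg hpos.le, inv_mul_cancel₀ hpos.ne']
    · rw [real_inner_smul_right,
        SurfaceCurve.inner_covDeriv_velocity hIo hγ.toIsArcLengthCurve ht, mul_zero]
    · rw [SurfaceCurve.geodesicCurvature, real_inner_smul_right, hall t ht,
        inv_mul_eq_iff_eq_mul₀ hpos.ne', ← sq, hsq]
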